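/- For a finite poset $P$ write $x\parallel y$ when $x\not\le y$ and $y\not\le x$, and let $L_1,\dots,L_t$ be all linear extensions of $P$. The fractional dimension $\dim^*(P)$ is the infimum (a minimum unless $P$ is a chain) of the positive real numbers $d$ for which there are non-negative reals $\alpha_1,\dots,\alpha_t$ with $\sum_{i=1}^t\alpha_i=d$ such that, for every ordered pair $(x,y)$ with $x\parallel y$ in $P$, $\sum\{\alpha_i : 1\le i\le t,\ x>y \text{ in } L_i\}\ge 1$. The standard example $S_d$ is the poset with minimal elements $a_1,\dots,a_d$ and maximal elements $b_1,\dots,b_d$, whose only strict relations are $a_i<b_j$ for $i\ne j$. Theorem. For every positive integer $c$, if $n>10(30c+52)$ is an integer and $P$ is any finite poset with $|P|\le 2n+1$ and $\dim^*(P)\ge n-c$, then $P$ contains a subposet isomorphic to the standard example $S_d$ for some integer $d\ge n-(30c+52)$. -/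

import Mathlib

/-- The ground set of the standard example `S_d`: minimal elements `a_i = min i` and
maximal elements `b_i = max i`, for `i : Fin d`. -/
inductive StandardExample (d : ℕ) : Type
  | min (i : Fin d) : StandardExample d
  | max (i : Fin d) : StandardExample d

namespace StandardExample

/-- The order of `S_d`: besides reflexivity, `a_i ≤ b_j` exactly when `i ≠ j`. -/
def Le {d : ℕ} : StandardExample d → StandardExample d → Prop
  | min i, min j => i = j
  | min i, max j => i ≠ j
  | max _, min _ => False
  | max i, max j => i = j

instance (d : ℕ) : PartialOrder (StandardExample d) where
  le := Le
  le_refl x := by cases x <;> simp [Le]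
  le_trans x y z := by
    cases x <;> cases y <;> cases z <;> simp only [Le] <;> grind
  le_antisymm x y := by
    cases x <;> cases y <;> simp only [Le] <;> grind

end StandardExample

/-- `P` contains `S_d`: some subposet of `P` is isomorphic to `S_d`. -/
def ContainsStandardExample (P : Type*) [PartialOrder P] (d : ℕ) : Prop :=
  Nonempty (StandardExample d ↪o P)

/-- A linear extension of the poset `P`: a linear order on the same ground set whose
relation contains the order of `P`. -/
@[ext]
structure LinExt (P : Type*) [PartialOrder P] where
  /-- the (non-strict) relation of the linear order -/
  rel : P → P → Prop
  refl : ∀ x, rel x x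
  trans : ∀ x y z, rel x y → rel y z → rel x z
  antisymm : ∀ x y, rel x y → rel y x → x = y
  total : ∀ x y, rel x y ∨ rel y x
  extends_le : ∀ x y, x ≤ y → rel x y

namespace LinExt

variable {P : Type*} [PartialOrder P]

/-- `x > y` in the linear extension `L`. -/
def Gt (L : LinExt P) (x y : P) : Prop := L.rel y x ∧ x ≠ y

instance [Finite P] : Finite (LinExt P) :=
  Finite.of_injective (fun L : LinExt P => L.rel) fun _ _ h => LinExt.ext h

noncomputable instance [Finite P] : Fintype (LinExt P) := Fintype.ofFinite _

end LinExt

/-- `x ∥ y` in `P`: neither `x ≤ y` nor `y ≤ x` (in particular `x ≠ y`). -/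
def Parallel {P : Type*} [PartialOrder P] (x y : P) : Prop := ¬ x ≤ y ∧ ¬ y ≤ x

open Classical in
/-- Nonnegative weights on the set of all linear extensions of `P` such that for every ordered
pair `(x, y)` with `x ∥ y` the linear extensions with `x > y` have total weight at least `1`. -/
def IsFractionalRealizer {P : Type*} [PartialOrder P] [Finite P] (w : LinExt P → ℝ) : Prop :=
  (∀ L, 0 ≤ w L) ∧
    ∀ x y : P, Parallel x y → 1 ≤ ∑ L ∈ Finset.univ.filter (fun L : LinExt P => L.Gt x y), w L

/-- The fractional dimension `dim*(P)` of a finite poset: the least positive real `d` that is the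
total weight of a fractional realizer. The set below is nonempty and bounded below by `0`; the
infimum is attained unless `P` is a chain, when it is `0` by this definition. -/
noncomputable def fractionalDim (P : Type*) [PartialOrder P] [Finite P] : ℝ :=
  sInf {d : ℝ | 0 < d ∧ ∃ w : LinExt P → ℝ, IsFractionalRealizer w ∧ ∑ L, w L = d}

/-!
All bounds on the fractional dimension come from monotone level functions: such a function yields a
linear extension that follows it (`exists_linExt_of_monotoneOn`), and a weighted family of them is
a fractional cover of certain incomparable pairs (`FracCovers`, `fracCovers_of_levels`). A cover of
all pairs of weight less than `n - c` contradicts the hypothesis, so every way of saving weight can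
be used only `O(c)` times. Putting a point as low, or as high, as possible in one linear extension
of weight `1` takes care of half of the pairs that it is in. Deleting a set of `k` points costs
`k + 1` (`fracCovers_meeting`).

By Dilworth's theorem a maximum antichain `A` has at least `n - c` points, so at most `n + c + 1`
points are outside it, namely a set `U` above `A` and a set `D` below it. One linear extension for
each point of `D ∪ U`, and two more, cover everything. Two points of `D ∪ U` can share a linear
extension unless they form an antichain in `U` or in `D`, or are comparable with one in `D` and the
other in `U` (`exists_fracCovers_stars`). After the deletion of `O(c)` points, therefore, `U` and
`D` are antichains with `D` entirely below `U`. In this situation weight about `max |D| |U|` suffices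
(`fracCovers_three_layers`): a random linear extension handles `D` in its lower part and `U` in its
upper part at the same time, and each point of `A` is sent to one of the two parts by a rule adapted
to the numbers of points of `D` and `U` that it is comparable with (`exists_placement_rule`). So one
of `D` and `U` has `O(c)` points and can be deleted as well.

Two antichains `X`, `Y` remain, `X` below `Y`. By König's theorem for the incomparability graph,
weight about `ν`, the size of a maximum matching, is enough (`exists_matching_fracCovers`), so `ν` is
at least `n - O(c)`. On the other hand weight `1 / 2` for each of the remaining points is enough as
well, and each path of three incomparabilities that consists of two edges of the matching joined by
a third saves another `1 / 2` (`exists_fracCovers_paths`). So there are only `O(c)` disjoint paths of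
this kind. The matched pairs outside a maximal family of them form the standard example. With the
constants kept, `d ≥ n - (23 c + 53)`, which suffices as `c ≥ 1`.
-/

namespace FractionalDimension

open Finset

/-! ### Hall's theorem with deficiency, and maximal matchings -/

/-- The deficiency form of Hall's theorem: all of `α` can be matched into `β` together with `δ`
extra points, where `δ` is the excess `|S| - |N(S)|` of some set `S`. -/
theorem exists_hall_deficiency {α β : Type*} [Fintype α] [Fintype β] (r : α → β → Prop) :
    ∃ (S : Finset α) (N : Finset β) (δ : ℕ) (g : α → β ⊕ Fin δ),
      (∀ b, b ∈ N ↔ ∃ a ∈ S, r a b) ∧ S.card = N.card + δ ∧ Function.Injective g ∧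
        ∀ a b, g a = Sum.inl b → r a b := by
  classical
  let N : Finset α → Finset β := fun S => univ.filter fun b => ∃ a ∈ S, r a b
  obtain ⟨S, -, hS⟩ := exists_max_image (univ : Finset (Finset α))
    (fun S => (S.card : ℤ) - (N S).card) ⟨∅, mem_univ _⟩
  have h0 : (N S).card ≤ S.card := by
    have := hS ∅ (mem_univ _)
    simp only [N, card_empty, notMem_empty, false_and, exists_false, filter_false] at this
    simp only [N]
    omega
  obtain ⟨δ, hδ⟩ := Nat.exists_eq_add_of_le h0
  let r' : α → β ⊕ Fin δ → Prop := fun a => Sum.elim (r a) fun _ => True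
  have hall : ∃ g : α → β ⊕ Fin δ, Function.Injective g ∧ ∀ a, r' a (g a) := by
    rw [← Fintype.all_card_le_filter_rel_iff_exists_injective]
    intro T
    rcases T.eq_empty_or_nonempty with rfl | ⟨t, ht⟩
    · simp
    have h1 : (univ.filter fun b => ∃ a ∈ T, r' a b) = (N T).disjSum univ := by
      ext b
      rcases b with b | b
      · simp [N, r']
      · simpa [r'] using ⟨t, ht⟩
    rw [h1, card_disjSum, card_univ, Fintype.card_fin]
    have := hS T (mem_univ _)
    omega
  obtain ⟨g, hg, hr⟩ := hall
  refine ⟨S, N S, δ, g, fun b => by simp [N], hδ, hg, fun a b h => ?_⟩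
  simpa [r', h] using hr a

/-- A maximal matching `M` in a relation `r` on `B`; `M.biUnion fun p => {p.1, p.2}` is the set of
matched points, and no two unmatched points are related. -/
theorem exists_maximal_matching {α : Type*} [DecidableEq α] (B : Finset α) (r : α → α → Prop) :
    ∃ M : Finset (α × α), (∀ p ∈ M, p.1 ∈ B ∧ p.2 ∈ B ∧ p.1 ≠ p.2 ∧ r p.1 p.2) ∧
      (M : Set (α × α)).PairwiseDisjoint (fun p => ({p.1, p.2} : Finset α)) ∧
      (∀ x ∈ B \ M.biUnion fun p => {p.1, p.2}, ∀ y ∈ B \ M.biUnion fun p => {p.1, p.2},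
        x ≠ y → ¬ r x y) ∧
      (M.biUnion fun p => {p.1, p.2}) ⊆ B ∧
      (M.biUnion fun p => {p.1, p.2}).card = 2 * M.card := by
  classical
  let good : Finset (α × α) → Prop := fun M =>
    (∀ p ∈ M, p.1 ∈ B ∧ p.2 ∈ B ∧ p.1 ≠ p.2 ∧ r p.1 p.2) ∧
      (M : Set (α × α)).PairwiseDisjoint (fun p => ({p.1, p.2} : Finset α))
  obtain ⟨M, hM, hmax⟩ := exists_max_image ((B ×ˢ B).powerset.filter good) card
    ⟨∅, by simp [good]⟩
  simp only [mem_filter, mem_powerset] at hM hmax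
  obtain ⟨hMB, hM1, hM2⟩ := hM
  refine ⟨M, hM1, hM2, ?_, ?_, ?_⟩
  · intro x hx y hy hxy hr
    simp only [mem_sdiff, mem_biUnion, mem_insert, mem_singleton, not_exists, not_and,
      not_or] at hx hy
    have hnot : (x, y) ∉ M := fun h => (hx.2 _ h).1 rfl
    have := hmax (insert (x, y) M) ⟨?_, ?_, ?_⟩
    · rw [card_insert_of_notMem hnot] at this
      omega
    · intro p hp
      rcases mem_insert.1 hp with rfl | hp
      · exact mem_product.2 ⟨hx.1, hy.1⟩
      · exact hMB hp
    · intro p hp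
      rcases mem_insert.1 hp with rfl | hp
      · exact ⟨hx.1, hy.1, hxy, hr⟩
      · exact hM1 p hp
    · rw [coe_insert]
      refine hM2.insert fun p hp _ => ?_
      have h1 := hx.2 p hp
      have h2 := hy.2 p hp
      simp only [disjoint_insert_left, disjoint_singleton_left, mem_insert, mem_singleton]
      tauto
  · intro z hz
    simp only [mem_biUnion, mem_insert, mem_singleton] at hz
    obtain ⟨p, hp, rfl | rfl⟩ := hz
    · exact (hM1 p hp).1
    · exact (hM1 p hp).2.1
  · rw [card_biUnion hM2, sum_congr rfl fun p hp => card_pair (hM1 p hp).2.2.1]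
    simp [mul_comm]

/-! ### Random enumerations -/

section Enumerations

variable {α : Type*} [Fintype α] [DecidableEq α] {N : ℕ}

/-- In a random enumeration `σ`, the point `d` precedes all points of `W` with probability
`1 / (|W| + 1)`. -/
theorem card_precedes_mul (W : Finset α) {d : α} (hd : d ∉ W) :
    (univ.filter fun σ : α ≃ Fin N => ∀ w ∈ W, σ d < σ w).card * (W.card + 1) =
      Fintype.card (α ≃ Fin N) := by
  let F : α → Finset (α ≃ Fin N) := fun v =>
    univ.filter fun σ => ∀ w ∈ insert d W, w ≠ v → σ v < σ w
  have hF : (univ.filter fun σ : α ≃ Fin N => ∀ w ∈ W, σ d < σ w) = F d := by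
    ext σ
    simp only [F, mem_filter, mem_univ, true_and, mem_insert]
    constructor
    · rintro h w (rfl | hw) hne
      · exact absurd rfl hne
      · exact h w hw
    · intro h w hw
      exact h w (Or.inr hw) fun h' => hd (h' ▸ hw)
  have hdisj : ((insert d W : Finset α) : Set α).PairwiseDisjoint F := by
    intro v hv v' hv' hne
    refine disjoint_left.2 fun σ h h' => ?_
    simp only [F, mem_filter, mem_univ, true_and] at h h'
    exact lt_asymm (h v' hv' hne.symm) (h' v hv hne)
  have hcard : ∀ v ∈ insert d W, (F v).card = (F d).card := by
    intro v hv
    refine card_equiv (Equiv.equivCongr (Equiv.swap d v) (Equiv.refl _)) fun σ => ?_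
    simp only [F, mem_filter, mem_univ, true_and, Equiv.equivCongr_apply_apply,
      Equiv.symm_swap, Equiv.refl_apply, Equiv.swap_apply_left]
    have key : ∀ w ∈ insert d W, Equiv.swap d v w ∈ insert d W := by
      intro w hw
      rw [Equiv.swap_apply_def]
      split_ifs
      · exact hv
      · exact mem_insert_self d W
      · exact hw
    constructor
    · intro h w hw hne
      refine h _ (key w hw) fun h' => hne ?_
      have := congrArg (Equiv.swap d v) h'
      simpa using this
    · intro h w hw hne
      have := h _ (key w hw) fun h' => hne ?_
      · simpa using this
      · have := congrArg (Equiv.swap d v) h'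
        simpa using this
  have huniv : (univ : Finset (α ≃ Fin N)) = (insert d W).biUnion F := by
    refine (eq_univ_iff_forall.2 fun σ => ?_).symm
    obtain ⟨v, hv, hmin⟩ := exists_min_image (insert d W) σ ⟨d, mem_insert_self d W⟩
    refine mem_biUnion.2 ⟨v, hv, mem_filter.2 ⟨mem_univ σ, fun w hw hne => ?_⟩⟩
    exact lt_of_le_of_ne (hmin w hw) fun h => hne (σ.injective h).symm
  rw [hF, ← card_univ, huniv, card_biUnion hdisj, sum_congr rfl hcard, sum_const,
    card_insert_of_notMem hd, smul_eq_mul, mul_comm]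

/-- In a random enumeration, the first point of `D` lies in `W ⊆ D` with probability
`|W| / |D|`. -/
theorem card_exists_first_mul {W D : Finset α} (hWD : W ⊆ D) :
    (univ.filter fun σ : α ≃ Fin N => ∃ w ∈ W, ∀ d ∈ D, d ≠ w → σ w < σ d).card * D.card =
      W.card * Fintype.card (α ≃ Fin N) := by
  let F : α → Finset (α ≃ Fin N) := fun w => univ.filter fun σ => ∀ d ∈ D.erase w, σ w < σ d
  have hU : (univ.filter fun σ : α ≃ Fin N => ∃ w ∈ W, ∀ d ∈ D, d ≠ w → σ w < σ d) =
      W.biUnion F := by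
    ext σ
    simp only [F, mem_filter, mem_univ, true_and, mem_biUnion, mem_erase, and_imp]
    exact exists_congr fun w => and_congr_right fun _ =>
      ⟨fun h d hne hd => h d hd hne, fun h d hd hne => h d hne hd⟩
  have hdisj : (W : Set α).PairwiseDisjoint F := by
    intro v hv v' hv' hne
    refine disjoint_left.2 fun σ h h' => ?_
    simp only [F, mem_filter, mem_univ, true_and] at h h'
    exact lt_asymm (h v' (mem_erase.2 ⟨hne.symm, hWD hv'⟩)) (h' v (mem_erase.2 ⟨hne, hWD hv⟩))
  rw [hU, card_biUnion hdisj, sum_mul, ← smul_eq_mul, ← sum_const]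
  refine sum_congr rfl fun w hw => ?_
  rw [← card_precedes_mul (D.erase w) (notMem_erase w D), card_erase_add_one (hWD hw)]

open Classical in
/-- A rule `H` that decides, given random enumerations `σ = p.1`, `τ = p.2.1` and a coin `p.2.2`,
whether a middle point is placed high or low. Here `D`, `U` are the lower and the upper layer and
`W ⊆ D`, `V ⊆ U` consist of the points comparable with the middle point. The bounds say that with
probability at least `1 / M` the point goes low while a given `d ∈ D \ W` is listed before `W`, and
likewise that it goes high while a given `u ∈ U \ V` is listed before `V`. The listing alone has
probability `1 / (|W| + 1)` or `1 / (|V| + 1)`, so the rule favours the side on which it is less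
likely. -/
theorem exists_placement_rule {W D V U : Finset α} (hWD : W ⊆ D) (hVU : V ⊆ U) {M : ℕ}
    (hDM : D.card + 2 ≤ M) (hUM : U.card + 2 ≤ M) :
    ∃ H : (α ≃ Fin N) × (α ≃ Fin N) × Bool → Prop,
      (∀ d ∈ D \ W, Fintype.card ((α ≃ Fin N) × (α ≃ Fin N) × Bool) ≤
        M * (univ.filter fun p => ¬ H p ∧ ∀ w ∈ W, p.1 d < p.1 w).card) ∧
      ∀ u ∈ U \ V, Fintype.card ((α ≃ Fin N) × (α ≃ Fin N) × Bool) ≤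
        M * (univ.filter fun p => H p ∧ ∀ v ∈ V, p.2.1 u < p.2.1 v).card := by
  have hprod : ∀ (A B : (α ≃ Fin N) → Prop) (C : Bool → Prop)
      (Q : (α ≃ Fin N) × (α ≃ Fin N) × Bool → Prop) [DecidablePred A] [DecidablePred B]
      [DecidablePred C] {_ : DecidablePred Q},
      (∀ p, A p.1 ∧ B p.2.1 ∧ C p.2.2 → Q p) →
      (univ.filter A).card * ((univ.filter B).card * (univ.filter C).card) ≤
        (univ.filter Q).card := by
    intro A B C Q _ _ _ _ h
    rw [← card_product, ← card_product]
    refine card_le_card fun p hp => ?_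
    simp only [mem_product, mem_filter, mem_univ, true_and] at hp ⊢
    exact h p hp
  have hx := card_le_card hWD
  have hy := card_le_card hVU
  have hcardι : Fintype.card ((α ≃ Fin N) × (α ≃ Fin N) × Bool) =
      Fintype.card (α ≃ Fin N) * (Fintype.card (α ≃ Fin N) * 2) := by simp
  rw [hcardι]
  have hpW : ∀ d ∈ D \ W, _ := fun d hd =>
    card_precedes_mul (N := N) W (mem_sdiff.1 hd).2
  have hpV : ∀ u ∈ U \ V, _ := fun u hu =>
    card_precedes_mul (N := N) V (mem_sdiff.1 hu).2
  have hfW := card_exists_first_mul (N := N) hWD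
  have hfV := card_exists_first_mul (N := N) hVU
  have hT : (univ.filter fun _ : α ≃ Fin N => True).card = Fintype.card (α ≃ Fin N) := by simp
  have hT2 : (univ.filter fun _ : Bool => True).card = 2 := by simp
  have hc1 : (univ.filter fun b : Bool => b = true).card = 1 := rfl
  have hc2 : (univ.filter fun b : Bool => ¬ b = true).card = 1 := rfl
  generalize Fintype.card (α ≃ Fin N) = e at *
  by_cases h1 : 0 < W.card ∧ D.card * (V.card + 1) ≤ M * W.card
  · -- The point goes high when the first point of `D` is below it.
    refine ⟨fun p => ∃ w ∈ W, ∀ d ∈ D, d ≠ w → p.1 w < p.1 d, fun d hd => ?_, fun u hu => ?_⟩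
    · refine le_trans ?_ (Nat.mul_le_mul_left M (hprod (fun σ => ∀ w ∈ W, σ d < σ w) (fun _ => True) (fun _ => True) _ fun p hp =>
        ⟨fun ⟨w, hw, hf⟩ => lt_asymm (hp.1 w hw) (hf d (mem_sdiff.1 hd).1
          fun h => (mem_sdiff.1 hd).2 (h ▸ hw)), hp.1⟩))
      have hp := hpW d hd
      rw [hT, hT2]
      generalize (univ.filter fun σ : α ≃ Fin N => ∀ w ∈ W, σ d < σ w).card = q at *
      calc e * (e * 2) = (W.card + 1) * (q * (e * 2)) := by rw [← hp]; ring
        _ ≤ M * (q * (e * 2)) := Nat.mul_le_mul_right _ (by omega)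
    · refine le_trans ?_ (Nat.mul_le_mul_left M (hprod (fun σ => ∃ w ∈ W, ∀ d ∈ D, d ≠ w → σ w < σ d)
        (fun τ => ∀ v ∈ V, τ u < τ v) (fun _ => True) _ fun p hp =>
        ⟨hp.1, hp.2.1⟩))
      have hp := hpV u hu
      rw [hT2]
      generalize (univ.filter fun τ : α ≃ Fin N => ∀ v ∈ V, τ u < τ v).card = q at *
      generalize (univ.filter fun σ : α ≃ Fin N => ∃ w ∈ W, ∀ d ∈ D, d ≠ w → σ w < σ d).card = h
        at *
      have hk : 0 < D.card := h1.1.trans_le hx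
      refine Nat.le_of_mul_le_mul_left ?_ hk
      calc D.card * (e * (e * 2)) = (D.card * (V.card + 1)) * (q * e * 2) := by rw [← hp]; ring
        _ ≤ (M * W.card) * (q * e * 2) := Nat.mul_le_mul_right _ h1.2
        _ = M * (W.card * e) * (q * 2) := by ring
        _ = D.card * (M * (h * (q * 2))) := by rw [← hfW]; ring
  by_cases h2 : 0 < V.card ∧ U.card * (W.card + 1) ≤ M * V.card
  · -- The point goes low when the first point of `U` is above it.
    refine ⟨fun p => ¬ ∃ v ∈ V, ∀ u ∈ U, u ≠ v → p.2.1 v < p.2.1 u, fun d hd => ?_,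
      fun u hu => ?_⟩
    · refine le_trans ?_ (Nat.mul_le_mul_left M (hprod (fun σ => ∀ w ∈ W, σ d < σ w)
        (fun τ => ∃ v ∈ V, ∀ u ∈ U, u ≠ v → τ v < τ u) (fun _ => True) _ fun p hp =>
        ⟨not_not.2 hp.2.1, hp.1⟩))
      have hp := hpW d hd
      rw [hT2]
      generalize (univ.filter fun σ : α ≃ Fin N => ∀ w ∈ W, σ d < σ w).card = q at *
      generalize (univ.filter fun τ : α ≃ Fin N => ∃ v ∈ V, ∀ u ∈ U, u ≠ v → τ v < τ u).card = h
        at *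
      have hl : 0 < U.card := h2.1.trans_le hy
      refine Nat.le_of_mul_le_mul_left ?_ hl
      calc U.card * (e * (e * 2)) = (U.card * (W.card + 1)) * (q * e * 2) := by rw [← hp]; ring
        _ ≤ (M * V.card) * (q * e * 2) := Nat.mul_le_mul_right _ h2.2
        _ = M * (V.card * e) * (q * 2) := by ring
        _ = U.card * (M * (q * (h * 2))) := by rw [← hfV]; ring
    · refine le_trans ?_ (Nat.mul_le_mul_left M (hprod (fun _ => True) (fun τ => ∀ v ∈ V, τ u < τ v) (fun _ => True) _ fun p hp =>
        ⟨fun ⟨v, hv, hf⟩ => lt_asymm (hp.2.1 v hv) (hf u (mem_sdiff.1 hu).1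
          fun h => (mem_sdiff.1 hu).2 (h ▸ hv)), hp.2.1⟩))
      have hp := hpV u hu
      rw [hT, hT2]
      generalize (univ.filter fun τ : α ≃ Fin N => ∀ v ∈ V, τ u < τ v).card = q at *
      calc e * (e * 2) = (V.card + 1) * (e * (q * 2)) := by rw [← hp]; ring
        _ ≤ M * (e * (q * 2)) := Nat.mul_le_mul_right _ (by omega)
  · -- In the remaining case `|W| = |V|` is less than about half of `M`, and a fair coin will do.
    have hxy : W.card = V.card := by
      refine le_antisymm (not_lt.1 fun h => h1 ⟨by omega, ?_⟩) (not_lt.1 fun h => h2 ⟨by omega, ?_⟩)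
      · exact Nat.mul_le_mul (by omega) h
      · exact Nat.mul_le_mul (by omega) h
    have hM : 2 * (W.card + 1) ≤ M := by
      by_contra! hM
      refine h1 ⟨by omega, ?_⟩
      rw [← hxy]
      nlinarith [Nat.mul_le_mul_right W.card hDM]
    refine ⟨fun p => p.2.2 = true, fun d hd => ?_, fun u hu => ?_⟩
    · refine le_trans ?_ (Nat.mul_le_mul_left M (hprod (fun σ => ∀ w ∈ W, σ d < σ w) (fun _ => True) (fun b => ¬ b = true) _ fun p hp =>
        ⟨hp.2.2, hp.1⟩))
      have hp := hpW d hd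
      rw [hT, hc2]
      generalize (univ.filter fun σ : α ≃ Fin N => ∀ w ∈ W, σ d < σ w).card = q at *
      calc e * (e * 2) = (2 * (W.card + 1)) * (q * e) := by rw [← hp]; ring
        _ ≤ M * (q * e) := Nat.mul_le_mul_right _ hM
        _ = _ := by ring
    · refine le_trans ?_ (Nat.mul_le_mul_left M (hprod (fun _ => True) (fun τ => ∀ v ∈ V, τ u < τ v) (fun b => b = true) _ fun p hp =>
        ⟨hp.2.2, hp.2.1⟩))
      have hp := hpV u hu
      rw [hT, hc1]
      generalize (univ.filter fun τ : α ≃ Fin N => ∀ v ∈ V, τ u < τ v).card = q at *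
      calc e * (e * 2) = (2 * (V.card + 1)) * (q * e) := by rw [← hp]; ring
        _ ≤ M * (q * e) := Nat.mul_le_mul_right _ (hxy ▸ hM)
        _ = _ := by ring

end Enumerations

variable {P : Type*} [PartialOrder P]

/-! ### Double stars and standard examples -/

open Classical in
/-- The level function of the double star: `u` is put as low and `x` as high as possible. -/
noncomputable def starLevel (u x z : P) : ℕ :=
  (if z ≤ u then 0 else 1) + (if x ≤ z then 1 else 0)

theorem starLevel_monotone (u x : P) : Monotone (starLevel u x) := by
  intro z z' h
  unfold starLevel
  have h1 : z' ≤ u → z ≤ u := h.trans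
  have h2 : x ≤ z → x ≤ z' := fun h' => h'.trans h
  split_ifs <;> first | omega | (exfalso; tauto)

theorem starLevel_low {u x y : P} (hxu : ¬ x ≤ u) (hy : ¬ y ≤ u) :
    starLevel u x u < starLevel u x y := by
  simp [starLevel, hxu, hy]

theorem starLevel_high {u x y : P} (hxu : ¬ x ≤ u) (hy : ¬ x ≤ y) :
    starLevel u x y < starLevel u x x := by
  simp [starLevel, hxu, hy]; split_ifs <;> simp

/-- Two disjoint antichains, one above the other, contain a standard example, formed by the points
`z ∈ Z` and `φ z`, as soon as `φ` is a matching of incomparable pairs without further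
incomparabilities. -/
theorem containsStandardExample_of_matching {X Y Z : Finset P} {φ : P → P}
    (hX : IsAntichain (· ≤ ·) (X : Set P)) (hY : IsAntichain (· ≤ ·) (Y : Set P))
    (hXY : ∀ x ∈ X, ∀ y ∈ Y, ¬ y ≤ x) (hZX : Z ⊆ X) (hφ : ∀ z ∈ Z, φ z ∈ Y ∧ ¬ z ≤ φ z)
    (hinj : Set.InjOn φ Z) (hZ : ∀ z ∈ Z, ∀ z' ∈ Z, z ≠ z' → z ≤ φ z') :
    ContainsStandardExample P Z.card := by
  let e := Z.equivFin.symm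
  have heq : ∀ i j, (e i : P) = e j → i = j := fun i j h => e.injective (Subtype.ext h)
  refine ⟨OrderEmbedding.ofMapLEIff (fun s => match s with
    | .min i => (e i : P)
    | .max i => φ (e i)) ?_⟩
  rintro (i | i) (j | j)
  · refine ⟨fun h => heq i j (hX.eq (hZX (e i).2) (hZX (e j).2) h), ?_⟩
    rintro (rfl : i = j)
    exact le_rfl
  · refine ⟨?_, fun h : i ≠ j => hZ _ (e i).2 _ (e j).2 fun h' => h (heq i j h')⟩
    rintro h (rfl : i = j)
    exact (hφ _ (e i).2).2 h
  · exact ⟨fun h => absurd h (hXY _ (hZX (e j).2) _ (hφ _ (e i).2).1), fun h => h.elim⟩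
  · refine ⟨fun h => heq i j (hinj (e i).2 (e j).2
      (hY.eq (hφ _ (e i).2).1 (hφ _ (e j).2).1 h)), ?_⟩
    rintro (rfl : i = j)
    exact le_rfl

/-! ### Fractional covers -/

variable [Finite P]

/-- A level function that is monotone on a subset `S` is realized by a linear extension of the
whole poset: if `x` lies on a higher level than `y`, then `x` comes after `y`. -/
theorem exists_linExt_of_monotoneOn {S : Set P} {f : P → ℕ} (hf : MonotoneOn f S) :
    ∃ L : LinExt P, ∀ x ∈ S, ∀ y ∈ S, f y < f x → L.Gt x y := by
  classical
  have := Fintype.ofFinite P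
  -- `g` is the least monotone extension of `f` from `S` to `P`.
  let g : P → ℕ := fun z => (univ.filter fun s => s ∈ S ∧ s ≤ z).sup f
  have hg : Monotone g := fun z z' h => sup_mono fun s hs => by
    simp only [mem_filter, mem_univ, true_and] at hs ⊢
    exact ⟨hs.1, hs.2.trans h⟩
  have hgf : ∀ z ∈ S, g z = f z := fun z hz => le_antisymm
    (Finset.sup_le fun s hs => by
      simp only [mem_filter, mem_univ, true_and] at hs
      exact hf hs.1 hz hs.2)
    (le_sup (f := f) (by simpa using hz))
  let key : P → ℕ ×ₗ LinearExtension P := fun z => toLex (g z, toLinearExtension z)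
  have hkey : Monotone key := fun z z' h =>
    Prod.Lex.toLex_mono ⟨hg h, toLinearExtension.monotone h⟩
  have hinj : Function.Injective key := fun z z' h => congrArg (fun p => (ofLex p).2) h
  refine ⟨⟨fun x y => key x ≤ key y, fun x => le_rfl, fun x y z => le_trans,
    fun x y h h' => hinj (le_antisymm h h'), fun x y => le_total _ _, fun x y h => hkey h⟩, ?_⟩
  intro x hx y hy hlt
  refine ⟨?_, fun h => by simp [h] at hlt⟩
  rw [← hgf x hx, ← hgf y hy] at hlt
  exact (Prod.Lex.toLex_lt_toLex.2 (Or.inl hlt)).le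

open Classical in
/-- Linear extensions with nonnegative weights of total at most `t` that reverse every
incomparable pair `(x, y)` with `R x y` (so `x > y`) with total weight at least `1`. Thus `R`
selects the pairs to be taken care of, and a fractional realizer is the case where `R` holds
everywhere. -/
def FracCovers (R : P → P → Prop) (t : ℝ) : Prop :=
  ∃ w : LinExt P → ℝ, (∀ L, 0 ≤ w L) ∧ ∑ L, w L ≤ t ∧
    ∀ x y : P, Parallel x y → R x y → 1 ≤ ∑ L ∈ univ.filter (fun L : LinExt P => L.Gt x y), w L

theorem FracCovers.mono {R R' : P → P → Prop} {t t' : ℝ} (h : FracCovers R t)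
    (hR : ∀ x y, Parallel x y → R' x y → R x y) (ht : t ≤ t') : FracCovers R' t' := by
  obtain ⟨w, hw, hs, hc⟩ := h
  exact ⟨w, hw, hs.trans ht, fun x y hxy h' => hc x y hxy (hR x y hxy h')⟩

theorem FracCovers.add {R R' : P → P → Prop} {t t' : ℝ} (h : FracCovers R t)
    (h' : FracCovers R' t') : FracCovers (fun x y => R x y ∨ R' x y) (t + t') := by
  classical
  obtain ⟨w, hw, hs, hc⟩ := h
  obtain ⟨w', hw', hs', hc'⟩ := h'
  refine ⟨fun L => w L + w' L, fun L => add_nonneg (hw L) (hw' L), ?_, ?_⟩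
  · rw [sum_add_distrib]; exact add_le_add hs hs'
  · intro x y hxy hR
    rw [sum_add_distrib]
    have h1 := sum_nonneg (s := univ.filter (fun L : LinExt P => L.Gt x y)) fun L _ => hw L
    have h2 := sum_nonneg (s := univ.filter (fun L : LinExt P => L.Gt x y)) fun L _ => hw' L
    rcases hR with hR | hR
    · linarith [hc x y hxy hR]
    · linarith [hc' x y hxy hR]

open Classical in
/-- Weighted level functions give a fractional cover: only monotonicity on `S` is needed, because
`exists_linExt_of_monotoneOn` turns each of them into a linear extension. -/
theorem fracCovers_of_levels {ι : Type*} [Fintype ι] {S : Set P} {R : P → P → Prop}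
    (f : ι → P → ℕ) (hf : ∀ i, MonotoneOn (f i) S) (c : ι → ℝ) (hc : ∀ i, 0 ≤ c i)
    (hRS : ∀ x y, R x y → x ∈ S ∧ y ∈ S)
    (h : ∀ x y, Parallel x y → R x y → 1 ≤ ∑ i ∈ univ.filter (fun i => f i y < f i x), c i) :
    FracCovers R (∑ i, c i) := by
  choose L hL using fun i => exists_linExt_of_monotoneOn (hf i)
  refine ⟨fun L' => ∑ i ∈ univ.filter (fun i => L i = L'), c i,
    fun L' => sum_nonneg fun i _ => hc i, (sum_fiberwise _ _ _).le, ?_⟩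
  intro x y hxy hR
  refine (h x y hxy hR).trans ?_
  refine le_of_le_of_eq ?_ (sum_fiberwise_eq_sum_filter univ _ L c).symm
  refine sum_le_sum_of_subset_of_nonneg ?_ fun i _ _ => hc i
  intro i hi
  simp only [mem_filter, mem_univ, true_and] at hi ⊢
  exact hL i x (hRS x y hR).1 y (hRS x y hR).2 hi

/-- The case of `fracCovers_of_levels` in which every weight is `1`. -/
theorem fracCovers_of_levels_one {ι : Type*} [Fintype ι] {S : Set P} {R : P → P → Prop}
    (f : ι → P → ℕ) (hf : ∀ i, MonotoneOn (f i) S) (hRS : ∀ x y, R x y → x ∈ S ∧ y ∈ S)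
    (h : ∀ x y, Parallel x y → R x y → ∃ i, f i y < f i x) :
    FracCovers R (Fintype.card ι) := by
  classical
  have := fracCovers_of_levels (R := R) f hf (fun _ => 1) (fun _ => zero_le_one) hRS ?_
  · simpa using this
  · intro x y hxy hR
    obtain ⟨i, hi⟩ := h x y hxy hR
    exact single_le_sum (f := fun _ => (1 : ℝ)) (fun _ _ => zero_le_one)
      (mem_filter.2 ⟨mem_univ i, hi⟩)

theorem fractionalDim_le {t : ℝ} (ht : 0 < t) (h : FracCovers (fun _ _ : P => True) t) :
    fractionalDim P ≤ t := by
  classical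
  obtain ⟨w, hw, hs, hc⟩ := h
  refine csInf_le ⟨0, fun d hd => hd.1.le⟩ ⟨ht, ?_⟩
  -- Raise the weight of one linear extension so that the total becomes exactly `t`.
  obtain ⟨L₀, -⟩ := exists_linExt_of_monotoneOn (P := P) (S := Set.univ) (f := fun _ => 0)
    monotoneOn_const
  have h0 : ∀ L, w L ≤ w L + (if L = L₀ then t - ∑ L, w L else 0) := fun L => by
    split_ifs <;> linarith
  refine ⟨fun L => w L + (if L = L₀ then t - ∑ L, w L else 0), ⟨fun L => (hw L).trans (h0 L), ?_⟩,
    ?_⟩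
  · intro x y hxy
    exact (hc x y hxy trivial).trans (sum_le_sum fun L _ => h0 L)
  · simp [sum_add_distrib]

/-! ### Dilworth's theorem -/

/-- Dilworth's theorem: the poset is partitioned into chains, the colour classes of `col`, that
are no more than the points of some antichain. -/
theorem exists_antichain_chain_coloring : ∃ (A : Finset P) (δ : ℕ) (col : P → Fin δ),
    IsAntichain (· ≤ ·) (A : Set P) ∧ δ ≤ A.card ∧
      ∀ x y, col x = col y → x ≤ y ∨ y ≤ x := by
  classical
  have := Fintype.ofFinite P
  obtain ⟨S, N, δ, g, hN, hcard, hg, hlt⟩ := exists_hall_deficiency (fun x y : P => x < y)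
  -- Following the successors given by `g` upwards, every point reaches one of the `δ` extra
  -- points, its colour, in a number `F x` of steps.
  obtain ⟨F, hF⟩ : ∃ F : P → Fin δ × ℕ, ∀ x, (∀ y, g x = Sum.inl y →
      (F x).1 = (F y).1 ∧ (F x).2 = (F y).2 + 1) ∧
      (∀ i, g x = Sum.inr i → F x = (i, 0)) := by
    have wf : WellFounded (fun x y : P => y < x) := wellFounded_gt
    let step : ∀ x, (∀ y, x < y → Fin δ × ℕ) → Fin δ × ℕ := fun x IH =>
      match h : g x with
      | Sum.inl y => ((IH y (hlt x y h)).1, (IH y (hlt x y h)).2 + 1)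
      | Sum.inr i => (i, 0)
    refine ⟨wf.fix step, fun x => ⟨fun y hy => ?_, fun i hi => ?_⟩⟩
    · rw [wf.fix_eq]
      simp only [step]
      split
      · rename_i y' hy'
        obtain rfl : y' = y := by simpa [hy] using hy'.symm
        exact ⟨rfl, rfl⟩
      · rename_i i hi
        simp [hy] at hi
    · rw [wf.fix_eq]
      simp only [step]
      split
      · rename_i y' hy'
        simp [hi] at hy'
      · rename_i j hj
        obtain rfl : j = i := by simpa [hi] using hj.symm
        rfl
  have hinj : ∀ n x y, (F x).2 = n → (F x).1 = (F y).1 → (F x).2 = (F y).2 → x = y := by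
    intro n
    induction n with
    | zero =>
      intro x y hx h1 h2
      rcases hgx : g x with x' | i
      · have := ((hF x).1 x' hgx).2; omega
      rcases hgy : g y with y' | j
      · have := ((hF y).1 y' hgy).2; omega
      have e1 := (hF x).2 i hgx
      have e2 := (hF y).2 j hgy
      rw [e1, e2] at h1
      exact hg (by rw [hgx, hgy]; exact congrArg _ h1)
    | succ n ih =>
      intro x y hx h1 h2
      rcases hgx : g x with x' | i
      swap
      · have := (hF x).2 i hgx; simp [this] at hx
      rcases hgy : g y with y' | j
      swap
      · have := (hF y).2 j hgy; simp [this] at h2; omega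
      have e1 := (hF x).1 x' hgx
      have e2 := (hF y).1 y' hgy
      obtain rfl := ih x' y' (by omega) (by rw [← e1.1, ← e2.1, h1]) (by omega)
      exact hg (by rw [hgx, hgy])
  have hle : ∀ n x y, (F x).2 = n → (F x).1 = (F y).1 → (F y).2 ≤ (F x).2 → x ≤ y := by
    intro n
    induction n with
    | zero => exact fun x y hx h1 h2 => (hinj _ x y rfl h1 (by omega)).le
    | succ n ih =>
      intro x y hx h1 h2
      rcases h2.eq_or_lt with h2 | h2
      · exact (hinj _ x y rfl h1 h2.symm).le
      rcases hgx : g x with x' | i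
      · have e1 := (hF x).1 x' hgx
        exact (hlt x x' hgx).le.trans (ih x' y (by omega) (by rw [← e1.1, h1]) (by omega))
      · have := (hF x).2 i hgx; simp [this] at hx
  refine ⟨S \ N, δ, fun x => (F x).1, ?_, ?_, fun x y h => ?_⟩
  · intro x hx y hy hxy hle'
    simp only [coe_sdiff, Set.mem_sdiff, mem_coe] at hx hy
    exact hy.2 ((hN y).2 ⟨x, hx.1, lt_of_le_of_ne hle' hxy⟩)
  · have := le_card_sdiff N S; omega
  · rcases le_total (F y).2 (F x).2 with h' | h'
    · exact Or.inl (hle _ x y rfl h h')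
    · exact Or.inr (hle _ y x rfl h.symm h')

/-- A partition into `δ` chains gives a cover of weight `δ`: one linear extension for each chain,
putting all points of the chain as low as possible. -/
theorem fracCovers_of_chain_coloring {δ : ℕ} {col : P → Fin δ}
    (h : ∀ x y, col x = col y → x ≤ y ∨ y ≤ x) :
    FracCovers (fun _ _ : P => True) δ := by
  classical
  have := Fintype.ofFinite P
  have := fracCovers_of_levels_one (S := (Set.univ : Set P)) (R := fun _ _ => True)
    (fun (i : Fin δ) z => (univ.filter fun c => col c = i ∧ ¬ z ≤ c).card) ?_ (by simp) ?_
  · simpa using this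
  · intro i z _ z' _ hz
    refine card_le_card fun c hc => ?_
    simp only [mem_filter, mem_univ, true_and] at hc ⊢
    exact ⟨hc.1, fun h' => hc.2 (hz.trans h')⟩
  · intro x y hxy _
    refine ⟨col y, card_lt_card ?_⟩
    rw [ssubset_iff_of_subset]
    · exact ⟨y, by simpa using hxy.1, by simp⟩
    · intro c hc
      simp only [mem_filter, mem_univ, true_and] at hc ⊢
      exact ⟨hc.1, fun h' => hxy.1 (h'.trans ((h c y hc.1).resolve_right hc.2))⟩

/-! ### Deleting points, and layers -/

/-- Weight `|X| + 1` covers all pairs that meet `X`: if `x₁, …, xᵣ` lists `X` along a linear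
extension, then one linear extension can have `xᵢ` as low and `xᵢ₊₁` as high as possible. Hence
deleting the points of `X` lowers the fractional dimension by at most `|X| + 1`. -/
theorem fracCovers_meeting (X : Finset P) :
    FracCovers (fun x y => x ∈ X ∨ y ∈ X) (X.card + 1) := by
  classical
  obtain ⟨x, hx, hX⟩ : ∃ x : Fin X.card → P, (∀ i j, i < j → ¬ x j ≤ x i) ∧
      ∀ z ∈ X, ∃ i, x i = z := by
    let X' : Finset (LinearExtension P) := X.map ⟨toLinearExtension, fun _ _ h => h⟩
    have hX' : X'.card = X.card := card_map _
    obtain ⟨x, hx⟩ : ∃ x : Fin X.card → P, ∀ i, toLinearExtension (x i) = X'.orderEmbOfFin hX' i :=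
      ⟨fun i => X'.orderEmbOfFin hX' i, fun _ => rfl⟩
    refine ⟨x, fun i j hij h => ?_, fun z hz => ?_⟩
    · have h1 := toLinearExtension.monotone h
      rw [hx, hx] at h1
      exact absurd hij (not_lt.2 ((X'.orderEmbOfFin hX').le_iff_le.1 h1))
    · have : toLinearExtension z ∈ Set.range (X'.orderEmbOfFin hX') := by
        rw [range_orderEmbOfFin]
        exact mem_coe.2 (mem_map.2 ⟨z, hz, rfl⟩)
      obtain ⟨i, hi⟩ := this
      exact ⟨i, (hx i).trans hi⟩
  let f : Fin (X.card + 1) → P → ℕ := fun i z =>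
    (if ∃ j : Fin X.card, j.val + 1 = i.val ∧ ¬ z ≤ x j then 1 else 0) +
      (if ∃ j : Fin X.card, j.val = i.val ∧ x j ≤ z then 1 else 0)
  have hmono : ∀ i, Monotone (f i) := by
    intro i z z' h
    refine add_le_add ?_ ?_
    · split_ifs with h1 h2
      · exact le_rfl
      · obtain ⟨j, hj, hz⟩ := h1
        exact absurd ⟨j, hj, fun h' => hz (h.trans h')⟩ h2
      · exact zero_le_one
      · exact le_rfl
    · split_ifs with h1 h2
      · exact le_rfl
      · obtain ⟨j, hj, hz⟩ := h1
        exact absurd ⟨j, hj, hz.trans h⟩ h2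
      · exact zero_le_one
      · exact le_rfl
  have := fracCovers_of_levels_one (S := (Set.univ : Set P))
    (R := fun x y => x ∈ X ∨ y ∈ X) f (fun i => (hmono i).monotoneOn _) (by simp) ?_
  · simpa using this
  · rintro a b hab (ha | hb)
    · obtain ⟨j, rfl⟩ := hX a ha
      refine ⟨j.castSucc, ?_⟩
      have h2 : ¬ ∃ k : Fin X.card, k.val = j.castSucc.val ∧ x k ≤ b := by
        rintro ⟨k, hk, hkb⟩
        obtain rfl : k = j := Fin.ext (by simpa using hk)
        exact hab.1 hkb
      have h3 : ∃ k : Fin X.card, k.val = j.castSucc.val ∧ x k ≤ x j := ⟨j, by simp, le_rfl⟩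
      have h4 : (∃ k : Fin X.card, k.val + 1 = j.castSucc.val ∧ ¬ b ≤ x k) →
          ∃ k : Fin X.card, k.val + 1 = j.castSucc.val ∧ ¬ x j ≤ x k := by
        rintro ⟨k, hk, -⟩
        exact ⟨k, hk, hx k j (Fin.lt_def.2 (by simp at hk; omega))⟩
      simp only [f, if_neg h2, if_pos h3]
      split_ifs with h5 h6 <;> first | omega | exact absurd (h4 h5) h6
    · obtain ⟨j, rfl⟩ := hX b hb
      refine ⟨j.succ, ?_⟩
      have h1 : ∃ k : Fin X.card, k.val + 1 = j.succ.val ∧ ¬ a ≤ x k := ⟨j, by simp, hab.1⟩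
      have h2 : ¬ ∃ k : Fin X.card, k.val + 1 = j.succ.val ∧ ¬ x j ≤ x k := by
        rintro ⟨k, hk, hkb⟩
        obtain rfl : k = j := Fin.ext (by simpa using hk)
        exact hkb le_rfl
      have h3 : ¬ ∃ k : Fin X.card, k.val = j.succ.val ∧ x k ≤ x j := by
        rintro ⟨k, hk, hkb⟩
        exact hx j k (Fin.lt_def.2 (by simp at hk; omega)) hkb
      simp only [f, if_pos h1, if_neg h2, if_neg h3]
      omega

/-- Two linear extensions arranged in the layers of `ρ` cover all pairs that go down in `ρ`, and
also the pairs inside the layers that form antichains (the points of `T`), which are listed once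
in some order and once in the reverse order. -/
theorem fracCovers_layers {S T : Set P} {ρ : P → ℕ} (hρ : MonotoneOn ρ S)
    (hT : ∀ t ∈ T, ∀ z ∈ S, ρ t = ρ z → t ≤ z ∨ z ≤ t → t = z) :
    FracCovers (fun x y => (x ∈ S ∧ y ∈ S) ∧ (ρ y < ρ x ∨ ρ y = ρ x ∧ x ∈ T ∧ y ∈ T)) 2 := by
  classical
  obtain ⟨N, ⟨e⟩⟩ := Finite.exists_equiv_fin P
  let f : Bool → P → ℕ := fun b z =>
    ρ z * (N + 1) + if z ∈ T then (if b then (e z).val else N - (e z).val) else 0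
  have hlt : ∀ b z z', ρ z < ρ z' → f b z < f b z' := by
    intro b z z' h
    have h1 : (ρ z + 1) * (N + 1) ≤ ρ z' * (N + 1) := Nat.mul_le_mul_right _ h
    have h2 := (e z).isLt
    simp only [f]
    split_ifs <;> nlinarith [Nat.sub_le N (e z).val]
  have := fracCovers_of_levels_one (S := S)
    (R := fun x y => (x ∈ S ∧ y ∈ S) ∧ (ρ y < ρ x ∨ ρ y = ρ x ∧ x ∈ T ∧ y ∈ T)) f ?_
    (fun x y h => h.1) ?_
  · simpa using this
  · intro b z hz z' hz' h
    rcases (hρ hz hz' h).eq_or_lt with h' | h'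
    · by_cases hzT : z ∈ T
      · rw [hT z hzT z' hz' h' (Or.inl h)]
      by_cases hzT' : z' ∈ T
      · rw [hT z' hzT' z hz h'.symm (Or.inr h)]
      simp [f, h', hzT, hzT']
    · exact (hlt b z z' h').le
  · rintro x y hxy ⟨⟨hx, hy⟩, h | ⟨h, hxT, hyT⟩⟩
    · exact ⟨true, hlt _ _ _ h⟩
    · have hne : (e x).val ≠ (e y).val := fun h' =>
        hxy.1 (e.injective (Fin.ext h')).le
      have h1 := (e x).isLt
      have h2 := (e y).isLt
      rcases lt_or_gt_of_ne hne with h' | h'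
      · refine ⟨false, ?_⟩
        simp [f, hxT, hyT, h]
        omega
      · refine ⟨true, ?_⟩
        simpa [f, hxT, hyT, h] using h'

/-- Passing from a subset to the whole poset costs at most one more than the number of points
left out. -/
theorem FracCovers.extend [Fintype P] [DecidableEq P] {S : Finset P} {t : ℝ}
    (h : FracCovers (fun x y => x ∈ S ∧ y ∈ S) t) :
    FracCovers (fun _ _ : P => True) (t + (Sᶜ.card + 1)) := by
  refine (h.add (fracCovers_meeting Sᶜ)).mono (fun x y _ _ => ?_) le_rfl
  simp only [mem_compl]
  tauto

/-! ### Three layers -/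

open Classical in
/-- If `A` is an antichain between layers `D` and `U`, with all of `D` below all of `U`, then the
pairs between `A` and the other two layers need not much more than weight `max |D| |U|`, less than
the obvious `|D| + |U|`: a random linear extension can treat points of `D` and of `U` at the same time. Its lower part lists `D` downwards in the
order `σ`, its upper part lists `U` upwards in the order `τ`, and each point of `A` is put as low as
possible in the lower part or as high as possible in the upper part. -/
theorem fracCovers_three_layers {D A U : Finset P} (hA : IsAntichain (· ≤ ·) (A : Set P))
    (hDU : ∀ d ∈ D, ∀ u ∈ U, d < u) (hDA : ∀ d ∈ D, ∀ a ∈ A, ¬ a ≤ d)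
    (hAU : ∀ a ∈ A, ∀ u ∈ U, ¬ u ≤ a) {M : ℕ} (hDM : D.card + 2 ≤ M) (hUM : U.card + 2 ≤ M) :
    FracCovers (fun x y => x ∈ D ∧ y ∈ A ∨ x ∈ A ∧ y ∈ U) M := by
  have := Fintype.ofFinite P
  obtain ⟨N, ⟨e₀⟩⟩ := Finite.exists_equiv_fin P
  choose H hH₁ hH₂ using fun a : P => exists_placement_rule (N := N)
    (filter_subset (fun d => d ≤ a) D) (filter_subset (fun u => a ≤ u) U) hDM hUM
  let lo : (P ≃ Fin N) → P → ℕ := fun σ z =>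
    (D.filter fun d' => ∃ d ∈ D, σ d ≤ σ d' ∧ d ≤ z).card
  let hi : (P ≃ Fin N) → P → ℕ := fun τ z =>
    (U.filter fun u' => ∀ u ∈ U, τ u ≤ τ u' → ¬ z ≤ u).card
  have hlo : ∀ σ, Monotone (lo σ) := fun σ z z' h => card_le_card fun d' hd' => by
    simp only [mem_filter] at hd' ⊢
    obtain ⟨h0, d, hd, h1, h2⟩ := hd'
    exact ⟨h0, d, hd, h1, h2.trans h⟩
  have hhi : ∀ τ, Monotone (hi τ) := fun τ z z' h => card_le_card fun u' hu' => by
    simp only [mem_filter] at hu' ⊢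
    exact ⟨hu'.1, fun u hu h1 h2 => hu'.2 u hu h1 (h.trans h2)⟩
  have hloD : ∀ σ z, lo σ z ≤ D.card := fun σ z => card_filter_le _ _
  let f : (P ≃ Fin N) × (P ≃ Fin N) × Bool → P → ℕ := fun p z =>
    if z ∈ U ∨ z ∈ A ∧ H z p then D.card + hi p.2.1 z else lo p.1 z
  have hfmono : ∀ p, MonotoneOn (f p) ((D : Set P) ∪ A ∪ U) := by
    intro p z hz z' hz' hzz
    have hup : z ∈ U ∨ z ∈ A ∧ H z p → z' ∈ U ∨ z' ∈ A ∧ H z' p := by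
      simp only [Set.mem_union, mem_coe] at hz'
      rintro (h | ⟨h, h'⟩)
      · rcases hz' with (hz' | hz') | hz'
        · exact absurd hzz (hDU z' hz' z h).not_ge
        · exact absurd hzz (hAU z' hz' z h)
        · exact Or.inl hz'
      · rcases hz' with (hz' | hz') | hz'
        · exact absurd hzz (hDA z' hz' z h)
        · obtain rfl := hA.eq h hz' hzz
          exact Or.inr ⟨h, h'⟩
        · exact Or.inl hz'
    simp only [f]
    split_ifs with h1 h2 h2
    · exact Nat.add_le_add_left (hhi _ hzz) _
    · exact absurd (hup h1) h2
    · exact (hloD _ _).trans (Nat.le_add_right _ _)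
    · exact hlo _ hzz
  have hrevD : ∀ p, ∀ d ∈ D, ∀ a ∈ A, ¬ d ≤ a → ¬ H a p →
      (∀ w ∈ D.filter fun d => d ≤ a, p.1 d < p.1 w) → f p a < f p d := by
    intro p d hd a ha hda hH hw
    have h1 : ¬ (a ∈ U ∨ a ∈ A ∧ H a p) := by
      rintro (h | h)
      · exact hAU a ha a h le_rfl
      · exact hH h.2
    have h2 : ¬ (d ∈ U ∨ d ∈ A ∧ H d p) := by
      rintro (h | h)
      · exact (hDU d hd d h).ne rfl
      · exact hDA d hd d h.1 le_rfl
    simp only [f, if_neg h1, if_neg h2, lo]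
    simp only [mem_filter, and_imp] at hw
    refine card_lt_card ((ssubset_iff_of_subset fun d' hd' => ?_).2 ⟨d, ?_, ?_⟩)
    · simp only [mem_filter] at hd' ⊢
      obtain ⟨h0, d'', hd'', h3, h4⟩ := hd'
      exact ⟨h0, d, hd, (hw d'' hd'' h4).le.trans h3, le_rfl⟩
    · exact mem_filter.2 ⟨hd, d, hd, le_rfl, le_rfl⟩
    · simp only [mem_filter, not_and, not_exists]
      exact fun _ d'' hd'' h3 h4 => absurd h3 (hw d'' hd'' h4).not_ge
  have hrevU : ∀ p, ∀ a ∈ A, ∀ u ∈ U, ¬ a ≤ u → H a p →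
      (∀ v ∈ U.filter fun u => a ≤ u, p.2.1 u < p.2.1 v) → f p u < f p a := by
    intro p a ha u hu hau hH hv
    simp only [f, if_pos (Or.inl hu : u ∈ U ∨ u ∈ A ∧ H u p),
      if_pos (Or.inr ⟨ha, hH⟩ : a ∈ U ∨ a ∈ A ∧ H a p), hi]
    simp only [mem_filter, and_imp] at hv
    refine Nat.add_lt_add_left (card_lt_card ((ssubset_iff_of_subset fun u' hu' => ?_).2
      ⟨u, ?_, ?_⟩)) _
    · simp only [mem_filter] at hu' ⊢
      refine ⟨hu'.1, fun u'' hu'' h3 h4 => ?_⟩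
      exact hu'.2 u hu ((hv u'' hu'' h4).le.trans h3) le_rfl
    · simp only [mem_filter]
      exact ⟨hu, fun u'' hu'' h3 h4 => absurd h3 (hv u'' hu'' h4).not_ge⟩
    · simp only [mem_filter, not_and, not_forall, not_not]
      exact fun _ => ⟨u, hu, le_rfl, le_rfl⟩
  set c := Fintype.card ((P ≃ Fin N) × (P ≃ Fin N) × Bool) with hc
  have hcpos : (0 : ℝ) < c := by
    have : Nonempty ((P ≃ Fin N) × (P ≃ Fin N) × Bool) := ⟨e₀, e₀, true⟩
    exact_mod_cast Fintype.card_pos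
  refine (fracCovers_of_levels (R := fun x y => x ∈ D ∧ y ∈ A ∨ x ∈ A ∧ y ∈ U) f hfmono
    (fun _ => (M : ℝ) / c) (fun _ => by positivity) ?_ ?_).mono (fun _ _ _ h => h) ?_
  · rintro x y (⟨hx, hy⟩ | ⟨hx, hy⟩)
    · exact ⟨Or.inl (Or.inl hx), Or.inl (Or.inr hy)⟩
    · exact ⟨Or.inl (Or.inr hx), Or.inr hy⟩
  · intro x y hxy hR
    suffices h : c ≤ M * (univ.filter fun p => f p y < f p x).card by
      rw [sum_const, nsmul_eq_mul, mul_div_assoc', le_div_iff₀ hcpos, one_mul, mul_comm]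
      exact_mod_cast h
    rcases hR with ⟨hx, hy⟩ | ⟨hx, hy⟩
    · refine (hH₁ y x (by simp [hx, hxy.1])).trans (Nat.mul_le_mul_left _ (card_le_card ?_))
      intro p hp
      simp only [mem_filter, mem_univ, true_and] at hp ⊢
      exact hrevD p x hx y hy hxy.1 hp.1 (by simpa using hp.2)
    · refine (hH₂ x y (by simp [hy, hxy.1])).trans (Nat.mul_le_mul_left _ (card_le_card ?_))
      intro p hp
      simp only [mem_filter, mem_univ, true_and] at hp ⊢
      exact hrevU p x hx y hy hxy.1 hp.1 (by simpa using hp.2)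
  · rw [sum_const, card_univ, nsmul_eq_mul, ← hc, mul_div_cancel₀ _ hcpos.ne']

/-! ### Points above and below an antichain -/

/-- One linear extension for each point of `D ∪ U` covers all pairs `(x, y)` with `x ∈ D` or
`y ∈ U`, by putting the points of `D` high and those of `U` low. Each pair of a maximal matching
among points that can share a linear extension saves one of them; `R` is the set of matched points,
and the points outside `R` have the properties listed last. -/
theorem exists_fracCovers_stars [DecidableEq P] {D U : Finset P} (hdisj : ∀ u ∈ U, u ∉ D) :
    ∃ (R : Finset P) (m : ℕ), R ⊆ D ∪ U ∧ R.card = 2 * m ∧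
      FracCovers (fun x y => x ∈ D ∨ y ∈ U) (((D ∪ U).card : ℝ) - m) ∧
      IsAntichain (· ≤ ·) ((D \ R : Finset P) : Set P) ∧
      IsAntichain (· ≤ ·) ((U \ R : Finset P) : Set P) ∧
      ∀ d ∈ D \ R, ∀ u ∈ U \ R, d ≤ u := by
  classical
  -- `f` puts `q` low if `q ∈ U`, and high if `q ∈ D`.
  let Serves : (P → ℕ) → P → Prop := fun f q =>
    (q ∈ U → ∀ y, ¬ y ≤ q → f q < f y) ∧ (q ∈ D → ∀ y, ¬ q ≤ y → f y < f q)
  obtain ⟨M, hM, -, hfree, hsub, hcard⟩ := exists_maximal_matching (D ∪ U)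
    (fun b b' => (b ∈ U ∧ b' ∈ U ∧ b < b') ∨ (b ∈ D ∧ b' ∈ D ∧ b < b') ∨
      (b ∈ D ∧ b' ∈ U ∧ ¬ b ≤ b'))
  set Q := M.biUnion fun p => ({p.1, p.2} : Finset P)
  have hlow : ∀ b b' : P, b ≤ b' → ∃ f : P → ℕ, Monotone f ∧
      (∀ y, ¬ y ≤ b → f b < f y) ∧ ∀ y, ¬ y ≤ b' → f b' < f y := by
    intro b b' hbb
    refine ⟨fun z => (if z ≤ b then 0 else 1) + if z ≤ b' then 0 else 1, ?_, ?_, ?_⟩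
    · intro z z' h
      have h1 : z' ≤ b → z ≤ b := h.trans
      have h2 : z' ≤ b' → z ≤ b' := h.trans
      dsimp only
      split_ifs <;> first | omega | (exfalso; tauto)
    · intro y hy
      simp [hbb, hy]
    · intro y hy
      have h1 : ¬ y ≤ b := fun h => hy (h.trans hbb)
      simp only [le_refl, if_true, hy, h1, if_false]
      split_ifs <;> omega
  have hhigh : ∀ b b' : P, b ≤ b' → ∃ f : P → ℕ, Monotone f ∧
      (∀ y, ¬ b ≤ y → f y < f b) ∧ ∀ y, ¬ b' ≤ y → f y < f b' := by
    intro b b' hbb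
    refine ⟨fun z => (if b ≤ z then 1 else 0) + if b' ≤ z then 1 else 0, ?_, ?_, ?_⟩
    · intro z z' h
      have h1 : b ≤ z → b ≤ z' := fun h' => h'.trans h
      have h2 : b' ≤ z → b' ≤ z' := fun h' => h'.trans h
      dsimp only
      split_ifs <;> first | omega | (exfalso; tauto)
    · intro y hy
      have h1 : ¬ b' ≤ y := fun h => hy (hbb.trans h)
      simp [hy, h1]
    · intro y hy
      simp only [le_refl, if_true, hy, hbb, if_false]
      split_ifs <;> omega
  have hpair : ∀ p : M, ∃ f : P → ℕ, Monotone f ∧ Serves f p.1.1 ∧ Serves f p.1.2 := by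
    rintro ⟨⟨b, b'⟩, hp⟩
    obtain ⟨-, -, -, h | h | h⟩ := hM _ hp
    · obtain ⟨f, hf, h1, h2⟩ := hlow b b' h.2.2.le
      exact ⟨f, hf, ⟨fun _ => h1, fun hD => absurd hD (hdisj _ h.1)⟩,
        ⟨fun _ => h2, fun hD => absurd hD (hdisj _ h.2.1)⟩⟩
    · obtain ⟨f, hf, h1, h2⟩ := hhigh b b' h.2.2.le
      exact ⟨f, hf, ⟨fun hU => absurd h.1 (hdisj _ hU), fun _ => h1⟩,
        ⟨fun hU => absurd h.2.1 (hdisj _ hU), fun _ => h2⟩⟩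
    · exact ⟨starLevel b' b, starLevel_monotone _ _,
        ⟨fun hU => absurd h.1 (hdisj _ hU), fun _ _ => starLevel_high h.2.2⟩,
        ⟨fun _ _ => starLevel_low h.2.2, fun hD => absurd hD (hdisj _ h.2.1)⟩⟩
  have hsingle : ∀ b : ↥((D ∪ U) \ Q), ∃ f : P → ℕ, Monotone f ∧ Serves f b := by
    rintro ⟨b, hb⟩
    by_cases hU : b ∈ U
    · obtain ⟨f, hf, h1, -⟩ := hlow b b le_rfl
      exact ⟨f, hf, fun _ => h1, fun hD => absurd hD (hdisj _ hU)⟩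
    · obtain ⟨f, hf, h1, -⟩ := hhigh b b le_rfl
      exact ⟨f, hf, fun hU' => absurd hU' hU, fun _ => h1⟩
  choose f hf hf1 hf2 using hpair
  choose g hg hg1 using hsingle
  have hserves : ∀ b ∈ D ∪ U, ∃ i, Serves (Sum.elim f g i) b := by
    intro b hb
    by_cases hQ : b ∈ Q
    · obtain ⟨p, hp, hbp⟩ := mem_biUnion.1 hQ
      rcases mem_insert.1 hbp with rfl | hbp
      · exact ⟨.inl ⟨p, hp⟩, hf1 ⟨p, hp⟩⟩
      · rw [mem_singleton.1 hbp]
        exact ⟨.inl ⟨p, hp⟩, hf2 ⟨p, hp⟩⟩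
    · exact ⟨.inr ⟨b, mem_sdiff.2 ⟨hb, hQ⟩⟩, hg1 ⟨b, mem_sdiff.2 ⟨hb, hQ⟩⟩⟩
  refine ⟨Q, M.card, hsub, hcard, ?_, ?_, ?_, ?_⟩
  · refine (fracCovers_of_levels_one (S := Set.univ) (Sum.elim f g) ?_ (by simp) ?_).mono
      (fun _ _ _ h => h) ?_
    · rintro (i | i)
      · exact (hf i).monotoneOn _
      · exact (hg i).monotoneOn _
    · rintro x y hxy (hx | hy)
      · obtain ⟨i, hi⟩ := hserves x (mem_union_left _ hx)
        exact ⟨i, hi.2 hx y hxy.1⟩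
      · obtain ⟨i, hi⟩ := hserves y (mem_union_right _ hy)
        exact ⟨i, hi.1 hy x hxy.1⟩
    · have h := card_sdiff_add_card_eq_card hsub
      rw [hcard] at h
      have h' : (((D ∪ U) \ Q).card : ℝ) + 2 * M.card = (D ∪ U).card := by exact_mod_cast h
      simp only [Fintype.card_sum, Fintype.card_coe]
      push_cast
      linarith
  · intro x hx y hy hne hle
    have hx := mem_sdiff.1 (mem_coe.1 hx)
    have hy := mem_sdiff.1 (mem_coe.1 hy)
    exact hfree x (mem_sdiff.2 ⟨mem_union_left _ hx.1, hx.2⟩) y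
      (mem_sdiff.2 ⟨mem_union_left _ hy.1, hy.2⟩) hne
      (Or.inr (Or.inl ⟨hx.1, hy.1, lt_of_le_of_ne hle hne⟩))
  · intro x hx y hy hne hle
    have hx := mem_sdiff.1 (mem_coe.1 hx)
    have hy := mem_sdiff.1 (mem_coe.1 hy)
    exact hfree x (mem_sdiff.2 ⟨mem_union_right _ hx.1, hx.2⟩) y
      (mem_sdiff.2 ⟨mem_union_right _ hy.1, hy.2⟩) hne
      (Or.inl ⟨hx.1, hy.1, lt_of_le_of_ne hle hne⟩)
  · intro d hd u hu
    by_contra hle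
    have hd := mem_sdiff.1 hd
    have hu := mem_sdiff.1 hu
    exact hfree d (mem_sdiff.2 ⟨mem_union_left _ hd.1, hd.2⟩) u
      (mem_sdiff.2 ⟨mem_union_right _ hu.1, hu.2⟩) (fun h => hle h.le)
      (Or.inr (Or.inr ⟨hd.1, hu.1, hle⟩))

/-! ### Two layers -/

/-- König's theorem for the incomparability graph between `X` and `Y`: a maximum matching, given by
the points `x ∈ X'` and their partners `φ x`, is as large as a vertex cover, and putting the points
of a vertex cover high or low yields a fractional cover of that weight. -/
theorem exists_matching_fracCovers [DecidableEq P] (X Y : Finset P) :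
    ∃ (X' : Finset P) (φ : P → P), X' ⊆ X ∧ (∀ x ∈ X', φ x ∈ Y ∧ ¬ x ≤ φ x) ∧
      Set.InjOn φ X' ∧ FracCovers (fun x y => x ∈ X ∧ y ∈ Y) X'.card := by
  classical
  obtain ⟨S, N, δ, g, hN, hcard, hg, hr⟩ :=
    exists_hall_deficiency (fun (x : X) (y : Y) => ¬ (x : P) ≤ y)
  let X₁ : Finset X := univ.filter fun x => (g x).isLeft
  have hX₁ : ∀ x ∈ X₁, ∃ y, g x = Sum.inl y := fun x hx =>
    Sum.isLeft_iff.1 (mem_filter.1 hx).2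
  have hδ : X.card ≤ X₁.card + δ := by
    have h1 : (univ.filter fun x : X => ¬ (g x).isLeft).card ≤ δ := by
      have : (univ.filter fun x : X => ¬ (g x).isLeft).image g ⊆
          (univ : Finset (Fin δ)).map ⟨Sum.inr, Sum.inr_injective⟩ := by
        intro z hz
        obtain ⟨x, hx, rfl⟩ := mem_image.1 hz
        rcases hgx : g x with y | i
        · simp [hgx] at hx
        · simp
      have := card_le_card this
      rwa [card_image_of_injective _ hg, card_map, card_univ, Fintype.card_fin] at this
    have h2 := card_filter_add_card_filter_not (s := (univ : Finset X)) (fun x => (g x).isLeft)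
    rw [card_univ, Fintype.card_coe] at h2
    simp only [X₁]
    omega
  let φ : P → P := fun x =>
    if hx : x ∈ X then Sum.elim (fun y : Y => (y : P)) (fun _ => x) (g ⟨x, hx⟩) else x
  have hφ : ∀ (x : X) (y : Y), g x = Sum.inl y → φ x = y := fun x y h => by simp [φ, h]
  refine ⟨X₁.map (Function.Embedding.subtype _), φ, ?_, ?_, ?_, ?_⟩
  · intro x hx
    obtain ⟨x', -, rfl⟩ := mem_map.1 hx
    exact x'.2
  · intro x hx
    obtain ⟨x', hx', rfl⟩ := mem_map.1 hx
    obtain ⟨y, hy⟩ := hX₁ x' hx'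
    have := hr x' y hy
    rw [Function.Embedding.subtype_apply, hφ x' y hy]
    exact ⟨y.2, this⟩
  · intro x hx x' hx' h
    obtain ⟨a, ha, rfl⟩ := mem_map.1 (mem_coe.1 hx)
    obtain ⟨b, hb, rfl⟩ := mem_map.1 (mem_coe.1 hx')
    obtain ⟨y, hy⟩ := hX₁ a ha
    obtain ⟨z, hz⟩ := hX₁ b hb
    rw [Function.Embedding.subtype_apply, Function.Embedding.subtype_apply, hφ a y hy,
      hφ b z hz] at h
    rw [hg (a₁ := a) (a₂ := b) (by rw [hy, hz, Subtype.ext h])]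
  · have := fracCovers_of_levels_one (S := (Set.univ : Set P)) (R := fun x y => x ∈ X ∧ y ∈ Y)
      (Sum.elim (fun (x : {x : X // x ∉ S}) z => if (x.1 : P) ≤ z then 1 else 0)
        fun (y : N) z => if z ≤ (y.1 : P) then 0 else 1) ?_ (by simp) ?_
    · refine this.mono (fun _ _ _ h => h) ?_
      rw [card_map, Fintype.card_sum, Fintype.card_coe]
      have h1 : Fintype.card {x // x ∉ S} = X.card - S.card := by
        rw [Fintype.card_subtype_compl, Fintype.card_coe, Fintype.card_coe]
      rw [h1]
      have h2 := card_le_univ S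
      rw [Fintype.card_coe] at h2
      exact_mod_cast (by omega)
    · rintro (x | y) z - z' - h
      · have : (x.1 : P) ≤ z → (x.1 : P) ≤ z' := fun h' => h'.trans h
        simp only [Sum.elim_inl]
        split_ifs <;> first | omega | (exfalso; tauto)
      · have : z' ≤ (y.1 : P) → z ≤ (y.1 : P) := h.trans
        simp only [Sum.elim_inr]
        split_ifs <;> first | omega | (exfalso; tauto)
    · rintro x y hxy ⟨hx, hy⟩
      by_cases hS : (⟨x, hx⟩ : X) ∈ S
      · exact ⟨Sum.inr ⟨⟨y, hy⟩, (hN _).2 ⟨_, hS, hxy.1⟩⟩, by simp [hxy.1]⟩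
      · exact ⟨Sum.inl ⟨_, hS⟩, by simp [hxy.1]⟩

/-- Given a matching `x ↦ φ x` of incomparable pairs between `X` and `Y`, let weight `1 / 2` go to
every point of `X` being high and every point of `Y` being low. A matched pair needs weight `1` for
itself, but a path `φ b - b - φ b' - b'` of incomparable pairs needs only `3 / 2` in place of `2`.
Taking as many disjoint paths as possible leaves a set `Z` of matched pairs without such
incomparabilities between them. -/
theorem exists_fracCovers_paths [DecidableEq P] {X Y X' : Finset P} {φ : P → P} (hX' : X' ⊆ X)
    (hφ : ∀ x ∈ X', φ x ∈ Y ∧ ¬ x ≤ φ x) (hinj : Set.InjOn φ X') :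
    ∃ (Z : Finset P) (f : ℕ), Z ⊆ X' ∧ Z.card + 2 * f = X'.card ∧
      (∀ z ∈ Z, ∀ z' ∈ Z, z ≠ z' → z ≤ φ z') ∧
      FracCovers (fun x y => x ∈ X ∧ y ∈ Y) (((X.card : ℝ) + Y.card - f) / 2) := by
  classical
  obtain ⟨M, hM, -, hfree, hsub, hcard⟩ :=
    exists_maximal_matching X' (fun b b' => ¬ b ≤ φ b')
  set Q := M.biUnion fun p => ({p.1, p.2} : Finset P) with hQ
  have hYφ : X'.image φ ⊆ Y := fun y hy => by
    obtain ⟨x, hx, rfl⟩ := mem_image.1 hy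
    exact (hφ x hx).1
  have hcφ : (X'.image φ).card = X'.card := card_image_of_injOn hinj
  have hZ := card_sdiff_add_card_eq_card hsub
  refine ⟨X' \ Q, M.card, sdiff_subset, by omega, fun z hz z' hz' hne =>
    not_not.1 (hfree z hz z' hz' hne), ?_⟩
  let lev : (↥(X \ X') ⊕ ↥(Y \ X'.image φ)) ⊕ (↥(X' \ Q) ⊕ M × Fin 3) → P → ℕ :=
    Sum.elim (Sum.elim (fun x z => if (x : P) ≤ z then 1 else 0)
      (fun y z => if z ≤ (y : P) then 0 else 1))
      (Sum.elim (fun x => starLevel (φ x) x)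
        (fun p => ![starLevel (φ p.1.1.1) p.1.1.1, starLevel (φ p.1.1.2) p.1.1.1,
          starLevel (φ p.1.1.2) p.1.1.2] p.2))
  let c : (↥(X \ X') ⊕ ↥(Y \ X'.image φ)) ⊕ (↥(X' \ Q) ⊕ M × Fin 3) → ℝ :=
    Sum.elim (fun _ => 1 / 2) (Sum.elim (fun _ => 1) (fun _ => 1 / 2))
  have hc : ∀ i, 0 ≤ c i := by rintro (i | i | i) <;> norm_num [c]
  refine (fracCovers_of_levels (S := Set.univ) (R := fun x y => x ∈ X ∧ y ∈ Y) lev ?_ c hc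
    (by simp) ?_).mono (fun _ _ _ h => h) ?_
  · rintro ((x | y) | x | ⟨p, k⟩)
    · rintro z - z' - h
      have : (x : P) ≤ z → (x : P) ≤ z' := fun h' => h'.trans h
      simp only [lev, Sum.elim_inl]
      split_ifs <;> first | omega | (exfalso; tauto)
    · rintro z - z' - h
      have : z' ≤ (y : P) → z ≤ (y : P) := h.trans
      simp only [lev, Sum.elim_inl, Sum.elim_inr]
      split_ifs <;> first | omega | (exfalso; tauto)
    · exact (starLevel_monotone _ _).monotoneOn _
    · fin_cases k <;> exact (starLevel_monotone _ _).monotoneOn _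
  · rintro x y hxy ⟨hx, hy⟩
    have one : ∀ i, lev i y < lev i x → c i = 1 →
        1 ≤ ∑ i ∈ univ.filter (fun i => lev i y < lev i x), c i := fun i hi h1 => by
      rw [← h1]
      exact single_le_sum (fun i _ => hc i) (mem_filter.2 ⟨mem_univ i, hi⟩)
    have two : ∀ i j, i ≠ j → lev i y < lev i x → lev j y < lev j x → c i = 1 / 2 → c j = 1 / 2 →
        1 ≤ ∑ i ∈ univ.filter (fun i => lev i y < lev i x), c i := fun i j hij hi hj h1 h2 => by
      have : c i + c j ≤ ∑ i ∈ univ.filter (fun i => lev i y < lev i x), c i := by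
        rw [← sum_pair hij]
        refine sum_le_sum_of_subset_of_nonneg ?_ fun i _ _ => hc i
        intro k hk
        rcases mem_insert.1 hk with rfl | hk
        · exact mem_filter.2 ⟨mem_univ _, hi⟩
        · exact mem_filter.2 ⟨mem_univ _, (mem_singleton.1 hk) ▸ hj⟩
      linarith
    have hQcases : ∀ b ∈ X', b ∉ X' \ Q → ∃ p : M, b = p.1.1 ∨ b = p.1.2 := fun b hb hbQ => by
      have : b ∈ Q := by simpa [hb] using hbQ
      obtain ⟨p, hp, hb'⟩ := mem_biUnion.1 this
      exact ⟨⟨p, hp⟩, by simpa using hb'⟩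
    have h11 : ∀ p : M, ¬ p.1.1 ≤ φ p.1.1 := fun p => (hφ _ (hM p.1 p.2).1).2
    have h22 : ∀ p : M, ¬ p.1.2 ≤ φ p.1.2 := fun p => (hφ _ (hM p.1 p.2).2.1).2
    have h12 : ∀ p : M, ¬ p.1.1 ≤ φ p.1.2 := fun p => (hM p.1 p.2).2.2.2
    -- The linear extensions that put `x` high.
    have hxcases : (∃ i, lev i y < lev i x ∧ c i = 1) ∨
        (∃ i, lev (.inl (.inl i)) y < lev (.inl (.inl i)) x) ∨
        ∃ p, (lev (.inr (.inr (p, 0))) y < lev (.inr (.inr (p, 0))) x ∧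
            lev (.inr (.inr (p, 1))) y < lev (.inr (.inr (p, 1))) x) ∨
          lev (.inr (.inr (p, 2))) y < lev (.inr (.inr (p, 2))) x := by
      by_cases hxX : x ∈ X'
      · by_cases hxQ : x ∈ X' \ Q
        · exact Or.inl ⟨.inr (.inl ⟨x, hxQ⟩), starLevel_high (hφ x hxX).2 hxy.1, rfl⟩
        · obtain ⟨p, rfl | rfl⟩ := hQcases x hxX hxQ
          · exact Or.inr (Or.inr ⟨p, Or.inl ⟨starLevel_high (h11 p) hxy.1,
              starLevel_high (h12 p) hxy.1⟩⟩)
          · exact Or.inr (Or.inr ⟨p, Or.inr (starLevel_high (h22 p) hxy.1)⟩)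
      · exact Or.inr (Or.inl ⟨⟨x, mem_sdiff.2 ⟨hx, hxX⟩⟩, by simp [lev, hxy.1]⟩)
    -- The linear extensions that put `y` low.
    have hycases : (∃ i, lev i y < lev i x ∧ c i = 1) ∨
        (∃ i, lev (.inl (.inr i)) y < lev (.inl (.inr i)) x) ∨
        ∃ p, lev (.inr (.inr (p, 0))) y < lev (.inr (.inr (p, 0))) x ∨
          (lev (.inr (.inr (p, 1))) y < lev (.inr (.inr (p, 1))) x ∧
            lev (.inr (.inr (p, 2))) y < lev (.inr (.inr (p, 2))) x) := by
      by_cases hyX : y ∈ X'.image φ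
      · obtain ⟨b, hb, rfl⟩ := mem_image.1 hyX
        by_cases hbQ : b ∈ X' \ Q
        · exact Or.inl ⟨.inr (.inl ⟨b, hbQ⟩), starLevel_low (hφ b hb).2 hxy.1, rfl⟩
        · obtain ⟨p, rfl | rfl⟩ := hQcases b hb hbQ
          · exact Or.inr (Or.inr ⟨p, Or.inl (starLevel_low (h11 p) hxy.1)⟩)
          · exact Or.inr (Or.inr ⟨p, Or.inr ⟨starLevel_low (h12 p) hxy.1,
              starLevel_low (h22 p) hxy.1⟩⟩)
      · exact Or.inr (Or.inl ⟨⟨y, mem_sdiff.2 ⟨hy, hyX⟩⟩, by simp [lev, hxy.1]⟩)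
    rcases hxcases with ⟨i, hi, h1⟩ | ⟨i, hi⟩ | ⟨p, hp⟩
    · exact one i hi h1
    · rcases hycases with ⟨j, hj, h1⟩ | ⟨j, hj⟩ | ⟨q, hq | ⟨hq, -⟩⟩
      · exact one j hj h1
      · exact two _ _ (by simp) hi hj rfl rfl
      · exact two _ _ (by simp) hi hq rfl rfl
      · exact two _ _ (by simp) hi hq rfl rfl
    · rcases hycases with ⟨j, hj, h1⟩ | ⟨j, hj⟩ | ⟨q, hq⟩
      · exact one j hj h1
      · rcases hp with ⟨hp, -⟩ | hp <;> exact two _ _ (by simp) hp hj rfl rfl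
      · rcases hp with ⟨hp0, hp1⟩ | hp <;> rcases hq with hq | ⟨hq1, hq2⟩
        · exact two _ _ (by simp) hp1 hq rfl rfl
        · exact two _ _ (by simp) hp0 hq2 rfl rfl
        · exact two _ _ (by simp) hp hq rfl rfl
        · exact two _ _ (by simp) hp hq1 rfl rfl
  · have e1 := card_sdiff_add_card_eq_card hX'
    have e2 := card_sdiff_add_card_eq_card hYφ
    rw [hcφ] at e2
    have r1 : ((X \ X').card : ℝ) + X'.card = X.card := by exact_mod_cast e1
    have r2 : ((Y \ X'.image φ).card : ℝ) + X'.card = Y.card := by exact_mod_cast e2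
    have r3 : ((X' \ Q).card : ℝ) + 2 * M.card = X'.card := by
      rw [hcard] at hZ
      exact_mod_cast hZ
    simp only [c, Fintype.sum_sum_type, Sum.elim_inl, Sum.elim_inr, sum_const, card_univ,
      Fintype.card_coe, Fintype.card_prod, Fintype.card_fin, Fintype.card_sum, nsmul_eq_mul,
      mul_one]
    push_cast
    linarith

/-- The two-layer case: the bounds on the weight of a fractional cover and the size of the
standard example are linked by the size `ν` of a matching and the number `f` of paths. -/
theorem exists_standardExample_of_two_layers [DecidableEq P] {X Y : Finset P}
    (hX : IsAntichain (· ≤ ·) (X : Set P)) (hY : IsAntichain (· ≤ ·) (Y : Set P))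
    (hXY : ∀ x ∈ X, ∀ y ∈ Y, ¬ y ≤ x) :
    ∃ d f ν : ℕ, d + 2 * f = ν ∧ ContainsStandardExample P d ∧
      FracCovers (fun x y => x ∈ X ∪ Y ∧ y ∈ X ∪ Y) (ν + 2) ∧
      FracCovers (fun x y => x ∈ X ∪ Y ∧ y ∈ X ∪ Y) (((X.card : ℝ) + Y.card - f) / 2 + 2) := by
  obtain ⟨X', φ, hX', hφ, hinj, hcov⟩ := exists_matching_fracCovers X Y
  obtain ⟨Z, f, hZ, hcard, hZφ, hcov'⟩ := exists_fracCovers_paths hX' hφ hinj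
  have hlay : FracCovers (fun x y => (x ∈ X ∪ Y ∧ y ∈ X ∪ Y) ∧ ¬ (x ∈ X ∧ y ∈ Y)) 2 := by
    refine (fracCovers_layers (S := (X ∪ Y : Finset P)) (T := (X ∪ Y : Finset P))
      (ρ := fun z => if z ∈ X then 0 else 1) ?_ ?_).mono ?_ le_rfl
    · intro z hz z' hz' h
      dsimp only
      split_ifs with h1 h2
      · exact le_rfl
      · exact zero_le_one
      · exact absurd h (hXY z' ‹_› z ((mem_union.1 (mem_coe.1 hz)).resolve_left h1))
      · exact le_rfl
    · intro t ht z hz hρ h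
      rcases mem_union.1 (mem_coe.1 ht) with ht | ht <;>
        rcases mem_union.1 (mem_coe.1 hz) with hz | hz
      · exact h.elim (hX.eq ht hz) fun h => (hX.eq hz ht h).symm
      · have : z ∉ X := fun h => hXY z h z hz le_rfl
        simp [ht, this] at hρ
      · have : t ∉ X := fun h => hXY t h t ht le_rfl
        simp [hz, this] at hρ
      · exact h.elim (hY.eq ht hz) fun h => (hY.eq hz ht h).symm
    · rintro x y - ⟨h, hn⟩
      refine ⟨by simpa using h, ?_⟩
      by_cases hx : x ∈ X <;> by_cases hy : y ∈ X
      · exact Or.inr ⟨by simp [hx, hy], mem_coe.2 h.1, mem_coe.2 h.2⟩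
      · exact absurd ⟨hx, (mem_union.1 h.2).resolve_left hy⟩ hn
      · exact Or.inl (by simp [hx, hy])
      · exact Or.inr ⟨by simp [hx, hy], mem_coe.2 h.1, mem_coe.2 h.2⟩
  have hcomb : ∀ t, FracCovers (fun x y => x ∈ X ∧ y ∈ Y) t →
      FracCovers (fun x y => x ∈ X ∪ Y ∧ y ∈ X ∪ Y) (t + 2) := fun t h =>
    (h.add hlay).mono (fun x y _ h => by tauto) le_rfl
  exact ⟨Z.card, f, X'.card, hcard, containsStandardExample_of_matching hX hY hXY
    (hZ.trans hX') (fun z hz => hφ z (hZ hz)) (hinj.mono (coe_subset.2 hZ)) hZφ, hcomb _ hcov,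
    hcomb _ hcov'⟩

end FractionalDimension

/-! ### Limited savings force a standard example -/

open FractionalDimension Finset in
theorem theorem4p5 (c : ℕ) (hc : 0 < c) (n : ℕ) (hn : 10 * (30 * c + 52) < n)
    (P : Type*) [PartialOrder P] [Finite P] (hcard : Nat.card P ≤ 2 * n + 1)
    (hdim : (n : ℝ) - (c : ℝ) ≤ fractionalDim P) :
    ∃ d : ℕ, (n : ℤ) - (30 * (c : ℤ) + 52) ≤ (d : ℤ) ∧ ContainsStandardExample P d := by
  classical
  have := Fintype.ofFinite P
  rw [Nat.card_eq_fintype_card] at hcard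
  have hbound : ∀ t : ℝ, FracCovers (fun _ _ : P => True) t → (n : ℝ) - c ≤ t := by
    intro t ht
    by_contra! hlt
    -- The weight is raised to a positive number below `n - c`.
    have hpos : (0 : ℝ) < n - c - 1 / 2 := by
      have : (10 * (30 * c + 52) + 1 : ℝ) ≤ n := by exact_mod_cast hn
      have : (0 : ℝ) ≤ c := c.cast_nonneg
      linarith
    have := fractionalDim_le (lt_max_of_lt_right hpos)
      (ht.mono (fun _ _ _ h => h) (le_max_left t (n - c - 1 / 2 : ℝ)))
    have := hdim.trans this
    rcases le_max_iff.1 this with h | h <;> linarith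
  -- A maximum antichain `A`, and the points `U` above it and `D` below it.
  obtain ⟨A, hAanti, hAmax⟩ : ∃ A : Finset P, IsAntichain (· ≤ ·) (A : Set P) ∧
      ∀ B : Finset P, IsAntichain (· ≤ ·) (B : Set P) → B.card ≤ A.card := by
    obtain ⟨A, hA, hmax⟩ := exists_max_image
      (univ.filter fun B : Finset P => IsAntichain (· ≤ ·) (B : Set P)) card ⟨∅, by simp⟩
    exact ⟨A, (mem_filter.1 hA).2, fun B hB => hmax B (by simpa using hB)⟩
  have hAcard : (n : ℝ) - c ≤ A.card := by
    obtain ⟨B, δ, col, hB, hδ, hcol⟩ := exists_antichain_chain_coloring (P := P)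
    have := hbound _ (fracCovers_of_chain_coloring hcol)
    have h2 : (δ : ℝ) ≤ A.card := by exact_mod_cast hδ.trans (hAmax B hB)
    linarith
  have hAcomp : ∀ z, z ∉ A → (∃ a ∈ A, a < z) ∨ ∃ a ∈ A, z < a := by
    intro z hz
    by_contra! hno
    have hins : IsAntichain (· ≤ ·) ((insert z A : Finset P) : Set P) := by
      rw [coe_insert]
      refine hAanti.insert (fun b hb hne hle => ?_) fun b hb hne hle => ?_
      · exact hno.1 b hb (lt_of_le_of_ne hle hne.symm)
      · exact hno.2 b hb (lt_of_le_of_ne hle hne)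
    have := hAmax _ hins
    rw [card_insert_of_notMem hz] at this
    omega
  let U : Finset P := univ.filter fun z => ∃ a ∈ A, a < z
  let D : Finset P := univ.filter fun z => ∃ a ∈ A, z < a
  have hU : ∀ z, z ∈ U ↔ ∃ a ∈ A, a < z := fun z => by simp [U]
  have hD : ∀ z, z ∈ D ↔ ∃ a ∈ A, z < a := fun z => by simp [D]
  have hAA : ∀ a ∈ A, ∀ b ∈ A, ¬ a < b := fun a ha b hb h => h.ne (hAanti.eq ha hb h.le)
  have hDA : ∀ d ∈ D, ∀ a ∈ A, ¬ a ≤ d := fun d hd a ha h => by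
    obtain ⟨b, hb, hdb⟩ := (hD d).1 hd
    exact hAA a ha b hb (h.trans_lt hdb)
  have hAU : ∀ a ∈ A, ∀ u ∈ U, ¬ u ≤ a := fun a ha u hu h => by
    obtain ⟨b, hb, hbu⟩ := (hU u).1 hu
    exact hAA b hb a ha (hbu.trans_le h)
  have hUD : ∀ u ∈ U, ∀ d ∈ D, ¬ u ≤ d := fun u hu d hd h => by
    obtain ⟨b, hb, hdb⟩ := (hD d).1 hd
    exact hAU b hb u hu (h.trans hdb.le)
  have hall : ∀ z, z ∈ D ∨ z ∈ A ∨ z ∈ U := fun z => by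
    by_cases hz : z ∈ A
    · exact Or.inr (Or.inl hz)
    · rcases hAcomp z hz with h | h
      · exact Or.inr (Or.inr ((hU z).2 h))
      · exact Or.inl ((hD z).2 h)
  have hA_D : ∀ a ∈ A, a ∉ D := fun a ha h => hDA a h a ha le_rfl
  have hA_U : ∀ a ∈ A, a ∉ U := fun a ha h => hAU a ha a h le_rfl
  have hU_D : ∀ u ∈ U, u ∉ D := fun u hu h => hUD u hu u h le_rfl
  have hcardP : D.card + A.card + U.card = Fintype.card P := by
    rw [← card_union_of_disjoint (disjoint_left.2 fun z hz hz' => hA_D z hz' hz),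
      ← card_union_of_disjoint (disjoint_left.2 fun z hz hz' => ?_), ← card_univ]
    · congr 1
      refine eq_univ_of_forall fun z => ?_
      simpa [or_assoc] using hall z
    · exact (mem_union.1 hz).elim (hU_D z hz') fun h => hA_U z h hz'
  let ρ : P → ℕ := fun z => if z ∈ D then 0 else if z ∈ A then 1 else 2
  have hρD : ∀ z ∈ D, ρ z = 0 := fun z hz => by simp [ρ, hz]
  have hρA : ∀ z ∈ A, ρ z = 1 := fun z hz => by simp [ρ, hz, hA_D z hz]
  have hρU : ∀ z ∈ U, ρ z = 2 := fun z hz => by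
    simp [ρ, hU_D z hz, show z ∉ A from fun h => hA_U z h hz]
  have hρ : Monotone ρ := by
    intro z z' h
    rcases hall z with h1 | h1 | h1 <;> rcases hall z' with h2 | h2 | h2 <;>
      simp only [hρD, hρA, hρU, h1, h2, le_refl, zero_le] <;> norm_num
    · exact hDA z' h2 z h1 h
    · exact hUD z h1 z' h2 h
    · exact hAU z' h2 z h1 h
  -- Few points of `D ∪ U` can share a linear extension; the matched ones form the set `R`.
  obtain ⟨R, m, hR, hRm, hstar, hDanti, hUanti, hDU⟩ := exists_fracCovers_stars hU_D
  have hDUcard : (D ∪ U).card = D.card + U.card :=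
    card_union_of_disjoint (disjoint_left.2 fun z hz hz' => hU_D z hz' hz)
  have hm : (n : ℝ) - c ≤ ((D.card + U.card : ℕ) - m) + 2 := by
    rw [← hDUcard]
    refine hbound _ ((hstar.add (fracCovers_layers (S := Set.univ) (T := A) (ρ := ρ)
      (hρ.monotoneOn _) ?_)).mono ?_ le_rfl)
    · intro t ht z _ hρtz h
      have hz : z ∈ A := by
        rw [hρA t ht] at hρtz
        rcases hall z with h1 | h1 | h1
        · rw [hρD z h1] at hρtz; omega
        · exact h1
        · rw [hρU z h1] at hρtz; omega
      exact h.elim (hAanti.eq ht hz) fun h => (hAanti.eq hz ht h).symm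
    · intro x y _ _
      rcases hall x with h1 | h1 | h1 <;> rcases hall y with h2 | h2 | h2 <;>
        simp [hρD, hρA, hρU, h1, h2]
  set D₁ := D \ R with hD₁
  set U₁ := U \ R with hU₁
  have hD₁D : D₁ ⊆ D := sdiff_subset
  have hU₁U : U₁ ⊆ U := sdiff_subset
  have hAR : ∀ a ∈ A, a ∉ R := fun a ha h => (mem_union.1 (hR h)).elim (hA_D a ha) (hA_U a ha)
  have hall₁ : ∀ z, z ∉ R → z ∈ D₁ ∨ z ∈ A ∨ z ∈ U₁ := fun z hz => by
    simpa [hD₁, hU₁, hz] using hall z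
  have hcard₁ : D₁.card + U₁.card + 2 * m = D.card + U.card := by
    rw [← hDUcard, ← card_sdiff_add_card_eq_card hR, hRm, union_sdiff_distrib,
      card_union_of_disjoint (disjoint_left.2 fun z hz hz' => hU_D z (hU₁U hz') (hD₁D hz))]
  have hDU₁ : ∀ d ∈ D₁, ∀ u ∈ U₁, d < u := fun d hd u hu =>
    lt_of_le_not_ge (hDU d hd u hu) (hUD u (hU₁U hu) d (hD₁D hd))
  -- After deleting `R`, the smaller one of the two outer layers has few points.
  have hmax : (n : ℝ) - c ≤ (max D₁.card U₁.card + 2 : ℕ) + 2 + (2 * m + 1) := by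
    have h3 := fracCovers_three_layers (D := D₁) (A := A) (U := U₁) hAanti hDU₁
      (fun d hd => hDA d (hD₁D hd)) (fun a ha u hu => hAU a ha u (hU₁U hu))
      (M := max D₁.card U₁.card + 2) (by omega) (by omega)
    have hl := fracCovers_layers (S := {z | z ∉ R}) (T := {z | z ∉ R}) (ρ := ρ)
      (hρ.monotoneOn _) (by
        intro t ht z hz hρtz h
        rcases hall₁ t ht with h1 | h1 | h1 <;> rcases hall₁ z hz with h2 | h2 | h2
        · exact h.elim (hDanti.eq h1 h2) fun h => (hDanti.eq h2 h1 h).symm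
        · rw [hρD t (hD₁D h1), hρA z h2] at hρtz; omega
        · rw [hρD t (hD₁D h1), hρU z (hU₁U h2)] at hρtz; omega
        · rw [hρA t h1, hρD z (hD₁D h2)] at hρtz; omega
        · exact h.elim (hAanti.eq h1 h2) fun h => (hAanti.eq h2 h1 h).symm
        · rw [hρA t h1, hρU z (hU₁U h2)] at hρtz; omega
        · rw [hρU t (hU₁U h1), hρD z (hD₁D h2)] at hρtz; omega
        · rw [hρU t (hU₁U h1), hρA z h2] at hρtz; omega
        · exact h.elim (hUanti.eq h1 h2) fun h => (hUanti.eq h2 h1 h).symm)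
    have hmeet := fracCovers_meeting R
    rw [hRm] at hmeet
    push_cast at hmeet
    refine hbound _ (((h3.add hl).add hmeet).mono ?_ le_rfl)
    intro x y hxy _
    by_cases hx : x ∈ R
    · exact Or.inr (Or.inl hx)
    by_cases hy : y ∈ R
    · exact Or.inr (Or.inr hy)
    refine Or.inl ?_
    rcases hall₁ x hx with h1 | h1 | h1 <;> rcases hall₁ y hy with h2 | h2 | h2
    · exact Or.inr ⟨⟨hx, hy⟩, Or.inr ⟨by rw [hρD x (hD₁D h1), hρD y (hD₁D h2)], hx, hy⟩⟩
    · exact Or.inl (Or.inl ⟨h1, h2⟩)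
    · exact absurd (hDU₁ x h1 y h2).le hxy.1
    · exact Or.inr ⟨⟨hx, hy⟩, Or.inl (by rw [hρA x h1, hρD y (hD₁D h2)]; omega)⟩
    · exact Or.inr ⟨⟨hx, hy⟩, Or.inr ⟨by rw [hρA x h1, hρA y h2], hx, hy⟩⟩
    · exact Or.inl (Or.inr ⟨h1, h2⟩)
    · exact Or.inr ⟨⟨hx, hy⟩, Or.inl (by rw [hρU x (hU₁U h1), hρD y (hD₁D h2)]; omega)⟩
    · exact Or.inr ⟨⟨hx, hy⟩, Or.inl (by rw [hρU x (hU₁U h1), hρA y h2]; omega)⟩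
    · exact Or.inr ⟨⟨hx, hy⟩, Or.inr ⟨by rw [hρU x (hU₁U h1), hρU y (hU₁U h2)], hx, hy⟩⟩
  -- What remains are two layers: `A` and the larger one of the outer layers.
  obtain ⟨X, Y, hX, hY, hXY, hcardXY⟩ : ∃ X Y : Finset P, IsAntichain (· ≤ ·) (X : Set P) ∧
      IsAntichain (· ≤ ·) (Y : Set P) ∧ (∀ x ∈ X, ∀ y ∈ Y, ¬ y ≤ x) ∧
      X.card + Y.card = A.card + max D₁.card U₁.card := by
    rcases le_total D₁.card U₁.card with h | h
    · exact ⟨A, U₁, hAanti, hUanti, fun a ha u hu => hAU a ha u (hU₁U hu), by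
        rw [max_eq_right h]⟩
    · exact ⟨D₁, A, hDanti, hAanti, fun d hd => hDA d (hD₁D hd), by
        rw [max_eq_left h, add_comm]⟩
  obtain ⟨d, f, ν, hdf, hSE, hc1, hc2⟩ := exists_standardExample_of_two_layers hX hY hXY
  refine ⟨d, ?_, hSE⟩
  have hb1 := hbound _ hc1.extend
  have hb2 := hbound _ hc2.extend
  have hcompl : (X ∪ Y)ᶜ.card + (X.card + Y.card) = Fintype.card P := by
    rw [← card_union_of_disjoint (disjoint_left.2 fun z hz hz' => hXY z hz z hz' le_rfl),
      card_compl_add_card]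
  have hb1' : n ≤ ν + 2 + ((X ∪ Y)ᶜ.card + 1) + c := by
    have : (n : ℝ) ≤ ν + 2 + ((X ∪ Y)ᶜ.card + 1) + c := by linarith
    exact_mod_cast this
  have hb2' : 2 * n + f ≤ X.card + Y.card + 4 + 2 * ((X ∪ Y)ᶜ.card + 1) + 2 * c := by
    have : (2 * n + f : ℝ) ≤ X.card + Y.card + 4 + 2 * ((X ∪ Y)ᶜ.card + 1) + 2 * c := by linarith
    exact_mod_cast this
  have hA' : n ≤ A.card + c := by
    have : (n : ℝ) ≤ A.card + c := by linarith
    exact_mod_cast this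
  have hm' : n + m ≤ D.card + U.card + 2 + c := by
    have : (n + m : ℝ) ≤ D.card + U.card + 2 + c := by push_cast at hm; linarith
    exact_mod_cast this
  have hmax' : n ≤ max D₁.card U₁.card + 2 + 2 + (2 * m + 1) + c := by
    have : (n : ℝ) ≤ (max D₁.card U₁.card + 2 : ℕ) + 2 + (2 * m + 1) + c := by linarith
    exact_mod_cast this
  omega
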